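/- Let $\mathbb{F}$ be a field, $G$ a group, and $X$ a finite poset, and let $I(X)=\{f:X\times X\to\mathbb{F}\mid f(x,y)=0 \text{ whenever } x\not\le y\}$ be its incidence algebra over $\mathbb{F}$, with product $(fg)(x,y)=\sum_{x\le z\le y}f(x,z)g(z,y)$. Let $I(X)=\bigoplus_{g\in G}I(X)_g$ be a $G$-grading of $I(X)$, that is, a vector space decomposition with $I(X)_gI(X)_h\subseteq I(X)_{gh}$ for all $g,h\in G$. Assume at least one of the following conditions: $\operatorname{char}\mathbb{F}=0$, or $\operatorname{char}\mathbb{F}>\dim_{\mathbb{F}} I(X)$, or $G$ is abelian. Then there exist an integer $t\ge 0$ and finite abelian subgroups $H_1,\ldots,H_t\subseteq G$ such that, for each $i$, $\operatorname{char}\mathbb{F}$ does not divide $|H_i|$ and $\mathbb{F}$ contains a primitive $\exp(H_i)$-th root of unity; there exist $G$-graded $(\mathbb{F}H_i,\mathbb{F}H_j)$-bimodules $M_{i,j}$ for $1\le i<j\le t$; and there exist $\mathbb{F}$-bilinear products $M_{i,j}\times M_{j,k}\to M_{i,k}$ for $i<j<k$ that are compatible with the bimodule structures ($(am)n=a(mn)$,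 $(mc)n=m(cn)$, $m(nb)=(mn)b$), associative, and graded ($(M_{i,j})_g(M_{j,k})_h\subseteq (M_{i,k})_{gh}$), such that there is an isomorphism of $G$-graded algebras $$ I(X)\cong\left(\begin{array}{cccc}\mathbb{F}H_1&M_{1,2}&\ldots&M_{1,t}\\&\mathbb{F}H_2&\ddots&\vdots\\&&\ddots&M_{t-1,t}\\&&&\mathbb{F}H_t\end{array}\right). $$ Here the right-hand side is the algebra of block upper triangular matrices under matrix multiplication, each $\mathbb{F}H_i$ carries its canonical grading, in which $h\in H_i$ is homogeneous of degree $h$, and a block matrix is homogeneous of degree $g$ if and only if each of its blocks is homogeneous of degree $g$ (the zero block being homogeneous of every degree). -/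

import Mathlib

universe u v w

noncomputable section

/-- A grading of an `F`-algebra `A` by a (multiplicatively written) group `G`: a vector space
decomposition `A = ⨁ g, A_g` with `A_g A_h ⊆ A_{gh}`. -/
structure IsGroupGrading {F G A : Type*} [Field F] [Group G] [Ring A] [Algebra F A]
    (𝒜 : G → Submodule F A) : Prop where
  isInternal : open scoped Classical in DirectSum.IsInternal 𝒜
  mul_mem : ∀ (g h : G) (x y : A), x ∈ 𝒜 g → y ∈ 𝒜 h → x * y ∈ 𝒜 (g * h)

/-- The homogeneous component of degree `g` of the group algebra `FH`, for a subgroup `H` of `G`,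
in its canonical `G`-grading: it is spanned by the `h ∈ H` with `h = g`
(so it is `F g` if `g ∈ H`, and zero otherwise). -/
def groupAlgebraComponent (F : Type*) {G : Type*} [Field F] [Group G] (H : Subgroup G) (g : G) :
    Submodule F (MonoidAlgebra F H) :=
  Submodule.span F {a | ∃ h : H, (h : G) = g ∧ a = MonoidAlgebra.single h 1}

/-- A `G`-graded `(FH, FK)`-bimodule, for subgroups `H`, `K` of `G`. The right action of `FK` is
written as an action of the opposite algebra. -/
structure GradedBimodule (F : Type u) {G : Type v} [Field F] [Group G] (H K : Subgroup G) where
  /-- the underlying space -/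
  carrier : Type w
  [addCommGroup : AddCommGroup carrier]
  [module : Module F carrier]
  [leftModule : Module (MonoidAlgebra F H) carrier]
  [rightModule : Module (MonoidAlgebra F K)ᵐᵒᵖ carrier]
  [leftTower : IsScalarTower F (MonoidAlgebra F H) carrier]
  [rightTower : IsScalarTower F (MonoidAlgebra F K)ᵐᵒᵖ carrier]
  [smulComm : SMulCommClass (MonoidAlgebra F H) (MonoidAlgebra F K)ᵐᵒᵖ carrier]
  /-- the homogeneous components -/
  component : G → Submodule F carrier
  isInternal : open scoped Classical in DirectSum.IsInternal component
  left_mem : ∀ (g g' : G) (a : MonoidAlgebra F H) (m : carrier),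
    a ∈ groupAlgebraComponent F H g → m ∈ component g' → a • m ∈ component (g * g')
  right_mem : ∀ (g g' : G) (m : carrier) (b : MonoidAlgebra F K),
    m ∈ component g → b ∈ groupAlgebraComponent F K g' →
      MulOpposite.op b • m ∈ component (g * g')

namespace GradedBimodule

instance {F : Type u} {G : Type v} [Field F] [Group G] {H K : Subgroup G} :
    CoeSort (GradedBimodule.{u, v, w} F H K) (Type w) := ⟨carrier⟩

attribute [instance] addCommGroup module leftModule rightModule leftTower rightTower smulComm

end GradedBimodule

/-- The data of a graded block upper triangular algebra with diagonal blocks `FH_0, …, FH_{t-1}`: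
graded `(FH_i, FH_j)`-bimodules `M_ij` for `i < j`, and, for `i < j < k`, a product
`M_ij × M_jk → M_ik` which is `F`-bilinear, compatible with the bimodule structures
(including `FH_j`-balanced), associative and graded. -/
structure TriangularData (F : Type u) {G : Type v} [Field F] [Group G] {t : ℕ}
    (H : Fin t → Subgroup G) where
  /-- the blocks above the diagonal -/
  M : ∀ {i j : Fin t}, i < j → GradedBimodule.{u, v, w} F (H i) (H j)
  /-- the products of the blocks above the diagonal -/
  mul : ∀ {i j k : Fin t} (hij : i < j) (hjk : j < k),
    M hij →ₗ[F] M hjk →ₗ[F] M (hij.trans hjk)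
  smul_mul : ∀ {i j k : Fin t} (hij : i < j) (hjk : j < k) (a : MonoidAlgebra F (H i))
    (m : M hij) (n : M hjk), mul hij hjk (a • m) n = a • mul hij hjk m n
  mul_smul : ∀ {i j k : Fin t} (hij : i < j) (hjk : j < k) (m : M hij) (n : M hjk)
    (b : MonoidAlgebra F (H k)),
    mul hij hjk m (MulOpposite.op b • n) = MulOpposite.op b • mul hij hjk m n
  balanced : ∀ {i j k : Fin t} (hij : i < j) (hjk : j < k) (m : M hij)
    (c : MonoidAlgebra F (H j)) (n : M hjk),
    mul hij hjk (MulOpposite.op c • m) n = mul hij hjk m (c • n)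
  assoc : ∀ {i j k l : Fin t} (hij : i < j) (hjk : j < k) (hkl : k < l) (m : M hij) (n : M hjk)
    (p : M hkl), mul (hij.trans hjk) hkl (mul hij hjk m n) p
      = mul hij (hjk.trans hkl) m (mul hjk hkl n p)
  mul_mem : ∀ {i j k : Fin t} (hij : i < j) (hjk : j < k) (g g' : G) (m : M hij) (n : M hjk),
    m ∈ (M hij).component g → n ∈ (M hjk).component g' →
      mul hij hjk m n ∈ (M (hij.trans hjk)).component (g * g')

/-- The elements of the block upper triangular algebra: matrices with `(i, i)`-block in `FH_i`,
`(i, j)`-block in `M_ij` for `i < j`, and zero below the diagonal. -/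
@[ext]
structure TriangularAlgebra {F : Type u} {G : Type v} [Field F] [Group G] {t : ℕ}
    {H : Fin t → Subgroup G} (D : TriangularData.{u, v, w} F H) where
  /-- the diagonal blocks -/
  diag : ∀ i : Fin t, MonoidAlgebra F (H i)
  /-- the blocks above the diagonal -/
  off : ∀ {i j : Fin t} (h : i < j), D.M h

namespace TriangularAlgebra

variable {F : Type u} {G : Type v} [Field F] [Group G] {t : ℕ}
  {H : Fin t → Subgroup G} {D : TriangularData.{u, v, w} F H}

instance : Zero (TriangularAlgebra D) := ⟨⟨fun _ => 0, fun _ => 0⟩⟩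
instance : One (TriangularAlgebra D) := ⟨⟨fun _ => 1, fun _ => 0⟩⟩
instance : Add (TriangularAlgebra D) :=
  ⟨fun x y => ⟨fun i => x.diag i + y.diag i, fun h => x.off h + y.off h⟩⟩
instance : Neg (TriangularAlgebra D) := ⟨fun x => ⟨fun i => -x.diag i, fun h => -x.off h⟩⟩
instance : SMul F (TriangularAlgebra D) :=
  ⟨fun c x => ⟨fun i => c • x.diag i, fun h => c • x.off h⟩⟩

/-- Multiplication of block matrices. -/
instance : Mul (TriangularAlgebra D) :=
  ⟨fun x y => ⟨fun i => x.diag i * y.diag i, fun {i j} h =>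
    x.diag i • y.off h + MulOpposite.op (y.diag j) • x.off h
      + ∑ k : Set.Ioo i j, D.mul k.2.1 k.2.2 (x.off k.2.1) (y.off k.2.2)⟩⟩

@[simp] lemma diag_zero (i : Fin t) : (0 : TriangularAlgebra D).diag i = 0 := rfl
@[simp] lemma off_zero {i j : Fin t} (h : i < j) : (0 : TriangularAlgebra D).off h = 0 := rfl
@[simp] lemma diag_one (i : Fin t) : (1 : TriangularAlgebra D).diag i = 1 := rfl
@[simp] lemma off_one {i j : Fin t} (h : i < j) : (1 : TriangularAlgebra D).off h = 0 := rfl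
@[simp] lemma diag_add (x y : TriangularAlgebra D) (i : Fin t) :
    (x + y).diag i = x.diag i + y.diag i := rfl
@[simp] lemma off_add (x y : TriangularAlgebra D) {i j : Fin t} (h : i < j) :
    (x + y).off h = x.off h + y.off h := rfl
@[simp] lemma diag_neg (x : TriangularAlgebra D) (i : Fin t) : (-x).diag i = -x.diag i := rfl
@[simp] lemma off_neg (x : TriangularAlgebra D) {i j : Fin t} (h : i < j) :
    (-x).off h = -x.off h := rfl
@[simp] lemma diag_smul (c : F) (x : TriangularAlgebra D) (i : Fin t) :
    (c • x).diag i = c • x.diag i := rfl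
@[simp] lemma off_smul (c : F) (x : TriangularAlgebra D) {i j : Fin t} (h : i < j) :
    (c • x).off h = c • x.off h := rfl
@[simp] lemma diag_mul (x y : TriangularAlgebra D) (i : Fin t) :
    (x * y).diag i = x.diag i * y.diag i := rfl
@[simp] lemma off_mul (x y : TriangularAlgebra D) {i j : Fin t} (h : i < j) :
    (x * y).off h = x.diag i • y.off h + MulOpposite.op (y.diag j) • x.off h
      + ∑ k : Set.Ioo i j, D.mul k.2.1 k.2.2 (x.off k.2.1) (y.off k.2.2) := rfl

lemma ext_blocks {x y : TriangularAlgebra D} (h₁ : ∀ i, x.diag i = y.diag i)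
    (h₂ : ∀ (i j : Fin t) (h : i < j), x.off h = y.off h) : x = y :=
  TriangularAlgebra.ext (funext h₁)
    (funext fun i => funext fun j => funext fun h => h₂ i j h)

lemma sum_sum_assoc (x y z : TriangularAlgebra D) {i j : Fin t} (h : i < j) :
    (∑ k : Set.Ioo i j, ∑ l : Set.Ioo i k.1, D.mul (l.2.1.trans l.2.2) k.2.2
        (D.mul l.2.1 l.2.2 (x.off l.2.1) (y.off l.2.2)) (z.off k.2.2) : D.M h)
      = ∑ l : Set.Ioo i j, ∑ k : Set.Ioo l.1 j, D.mul l.2.1 (k.2.1.trans k.2.2) (x.off l.2.1)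
        (D.mul k.2.1 k.2.2 (y.off k.2.1) (z.off k.2.2)) := by
  rw [Finset.sum_sigma', Finset.sum_sigma']
  refine Finset.sum_bij'
    (fun p _ => ⟨⟨p.2.1, p.2.2.1, p.2.2.2.trans p.1.2.2⟩, ⟨p.1.1, p.2.2.2, p.1.2.2⟩⟩)
    (fun p _ => ⟨⟨p.2.1, p.1.2.1.trans p.2.2.1, p.2.2.2⟩, ⟨p.1.1, p.1.2.1, p.2.2.1⟩⟩)
    ?_ ?_ ?_ ?_ ?_
  · simp
  · simp
  · simp
  · simp
  · rintro ⟨k, l⟩ -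
    exact D.assoc _ _ _ _ _ _

lemma add_rearrange {A : Type*} [AddCommGroup A] {a b b' c d e f p q : A} (hb : b = b')
    (hp : p = q) : a + (b + c + d) + (e + f + p) = a + b' + e + c + (f + d + q) := by
  subst hb hp
  abel

lemma mul_assoc_aux (x y z : TriangularAlgebra D) : x * y * z = x * (y * z) := by
  refine ext_blocks (fun _ => mul_assoc _ _ _) (fun i j h => ?_)
  have key := sum_sum_assoc x y z h
  simp only [off_mul, diag_mul, smul_add, map_add, LinearMap.add_apply, map_sum,
    LinearMap.sum_apply, Finset.sum_add_distrib, Finset.smul_sum, D.smul_mul, D.mul_smul,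
    D.balanced, MulOpposite.op_mul, mul_smul]
  exact add_rearrange (smul_comm _ _ _).symm key

instance : Ring (TriangularAlgebra D) where
  add_assoc _ _ _ := ext_blocks (fun _ => add_assoc _ _ _) (fun _ _ _ => add_assoc _ _ _)
  zero_add _ := ext_blocks (fun _ => zero_add _) (fun _ _ _ => zero_add _)
  add_zero _ := ext_blocks (fun _ => add_zero _) (fun _ _ _ => add_zero _)
  add_comm _ _ := ext_blocks (fun _ => add_comm _ _) (fun _ _ _ => add_comm _ _)
  neg_add_cancel _ := ext_blocks (fun _ => neg_add_cancel _) (fun _ _ _ => neg_add_cancel _)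
  nsmul := nsmulRec
  zsmul := zsmulRec
  zero_mul _ := ext_blocks (by simp) (by simp)
  mul_zero _ := ext_blocks (by simp) (by simp)
  one_mul _ := ext_blocks (by simp) (by simp)
  mul_one _ := ext_blocks (by simp) (by simp)
  left_distrib x y z := ext_blocks (fun _ => mul_add _ _ _) (fun i j h => by
    simp only [off_mul, off_add, diag_add, smul_add, MulOpposite.op_add, add_smul, map_add,
      Finset.sum_add_distrib]
    abel)
  right_distrib x y z := ext_blocks (fun _ => add_mul _ _ _) (fun i j h => by
    simp only [off_mul, off_add, diag_add, smul_add, add_smul, map_add, LinearMap.add_apply,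
      Finset.sum_add_distrib]
    abel)
  mul_assoc := mul_assoc_aux

instance : Module F (TriangularAlgebra D) where
  one_smul _ := ext_blocks (fun _ => one_smul _ _) (fun _ _ _ => one_smul _ _)
  mul_smul _ _ _ := ext_blocks (fun _ => mul_smul _ _ _) (fun _ _ _ => mul_smul _ _ _)
  smul_zero _ := ext_blocks (fun _ => smul_zero _) (fun _ _ _ => smul_zero _)
  smul_add _ _ _ := ext_blocks (fun _ => smul_add _ _ _) (fun _ _ _ => smul_add _ _ _)
  add_smul _ _ _ := ext_blocks (fun _ => add_smul _ _ _) (fun _ _ _ => add_smul _ _ _)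
  zero_smul _ := ext_blocks (fun _ => zero_smul _ _) (fun _ _ _ => zero_smul _ _)

instance : Algebra F (TriangularAlgebra D) :=
  Algebra.ofModule
    (fun c x y => ext_blocks (fun _ => by simp) (fun i j h => by
      have h1 : MulOpposite.op (y.diag j) • c • x.off h
          = c • MulOpposite.op (y.diag j) • x.off h := by
        rw [← algebraMap_smul (MonoidAlgebra F (H j))ᵐᵒᵖ c (x.off h),
          ← algebraMap_smul (MonoidAlgebra F (H j))ᵐᵒᵖ c (MulOpposite.op (y.diag j) • x.off h),
          ← mul_smul, ← mul_smul, Algebra.commutes]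
      simp only [off_mul, off_smul, diag_smul, smul_add, Finset.smul_sum, map_smul,
        LinearMap.smul_apply, smul_assoc, h1]))
    (fun c x y => ext_blocks (fun _ => by simp) (fun i j h => by
      have h1 : x.diag i • c • y.off h = c • x.diag i • y.off h := by
        rw [← algebraMap_smul (MonoidAlgebra F (H i)) c (y.off h),
          ← algebraMap_smul (MonoidAlgebra F (H i)) c (x.diag i • y.off h),
          ← mul_smul, ← mul_smul, Algebra.commutes]
      simp only [off_mul, off_smul, diag_smul, smul_add, Finset.smul_sum, map_smul,
        MulOpposite.op_smul, smul_assoc, h1]))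

/-- The canonical `G`-grading of the block upper triangular algebra: a matrix is homogeneous of
degree `g` if all of its blocks are. -/
def component (D : TriangularData.{u, v, w} F H) (g : G) : Submodule F (TriangularAlgebra D) where
  carrier := {x | (∀ i, x.diag i ∈ groupAlgebraComponent F (H i) g) ∧
    ∀ (i j : Fin t) (h : i < j), x.off h ∈ (D.M h).component g}
  add_mem' hx hy := ⟨fun i => add_mem (hx.1 i) (hy.1 i),
    fun i j h => add_mem (hx.2 i j h) (hy.2 i j h)⟩
  zero_mem' := ⟨fun _ => zero_mem _, fun _ _ _ => zero_mem _⟩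
  smul_mem' c _ hx := ⟨fun i => Submodule.smul_mem _ c (hx.1 i),
    fun i j h => Submodule.smul_mem _ c (hx.2 i j h)⟩

end TriangularAlgebra

end

/-! Let J be the kernel of `diagHom`, the functions vanishing on the diagonal. J consists of the
nilpotent elements, and A/J embeds in the commutative algebra F^X. The hypothesis on F and G serves
only to show that J is graded (`diagHom_proj`). For abelian G, J is a sum of commutators, and
homogeneous components of commutators stay in J. For characteristic zero or large, J is the radical
of the trace form of the regular representation, which respects degrees.

The degree-one component has some image R in F^X. The indicators of the classes of points that R
does not separate lie in R and lift to complete orthogonal idempotents e_i of degree 1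
(`exists_isHomogeneousFrame`). A homogeneous element of e_iAe_i outside J has a power equal to a
nonzero scalar times e_i modulo J (`exists_pow`). Hence a nonzero homogeneous element of e_iJe_j has
a nonzero row at every point of class i, and so each such point lies strictly below a point of class
j (`exists_lt`). Comparing the maximal ranks of classes (`classRank_lt`) gives e_iJe_i = 0 and an
ordering of the e_i that makes A block triangular.

Since e_iAe_i meets J trivially, it is commutative and its homogeneous components are at most
one-dimensional. Normalizing their generators at one point makes them multiplicative, so the corner
is FH_i. The other points of the class give characters that separate H_i, which forces the root of
unity (`exists_groupAlgebra`). The Peirce decomposition along the e_i is the required matrix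
algebra. -/

noncomputable section

/-! ### Homogeneous projections in a graded algebra. -/

namespace IsGroupGrading

variable {F G A : Type*} [Field F] [Group G] [Ring A] [Algebra F A] {𝒜 : G → Submodule F A}

open scoped Classical in
/-- The projection onto the homogeneous component of degree `g`, as a linear endomorphism. -/
def proj (h : IsGroupGrading 𝒜) (g : G) : A →ₗ[F] A :=
  (𝒜 g).subtype ∘ₗ DirectSum.component F G (fun g => 𝒜 g) g ∘ₗ
    (LinearEquiv.ofBijective (DirectSum.coeLinearMap 𝒜) h.isInternal).symm.toLinearMap

variable (h : IsGroupGrading 𝒜)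

include h

lemma proj_mem (g : G) (a : A) : h.proj g a ∈ 𝒜 g := Submodule.coe_mem _

lemma symm_of_mem {g : G} {a : A} (ha : a ∈ 𝒜 g) :
    open scoped Classical in
    (LinearEquiv.ofBijective (DirectSum.coeLinearMap 𝒜) h.isInternal).symm a =
      DirectSum.lof F G (fun g => 𝒜 g) g ⟨a, ha⟩ := by
  classical
  rw [LinearEquiv.symm_apply_eq]
  exact (DirectSum.coeLinearMap_lof 𝒜 g ⟨a, ha⟩).symm

lemma proj_of_mem {g : G} {a : A} (ha : a ∈ 𝒜 g) : h.proj g a = a := by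
  simp [proj, h.symm_of_mem ha, DirectSum.component.lof_self]

lemma proj_of_mem_of_ne {g k : G} {a : A} (ha : a ∈ 𝒜 g) (hgk : g ≠ k) : h.proj k a = 0 := by
  classical
  simp only [proj, LinearMap.comp_apply, LinearEquiv.coe_coe, h.symm_of_mem ha]
  rw [DirectSum.component.of, dif_neg hgk]
  simp

lemma exists_sum_proj (a : A) : ∃ s : Finset G, a = ∑ g ∈ s, h.proj g a := by
  classical
  obtain ⟨x, rfl⟩ := h.isInternal.surjective a
  refine ⟨x.support, ?_⟩
  have hx : ∀ g, h.proj g (DirectSum.coeAddMonoidHom 𝒜 x) = x g := by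
    intro g
    have : (LinearEquiv.ofBijective (DirectSum.coeLinearMap 𝒜) h.isInternal).symm
        (DirectSum.coeAddMonoidHom 𝒜 x) = x := by
      rw [LinearEquiv.symm_apply_eq]; rfl
    simp only [proj, LinearMap.comp_apply, LinearEquiv.coe_coe]
    rw [this]; rfl
  simp only [hx]
  rw [DirectSum.coeAddMonoidHom_eq_dfinsuppSum, DFinsupp.sum]

lemma eq_zero_of_proj {a : A} (ha : ∀ g, h.proj g a = 0) : a = 0 := by
  obtain ⟨s, hs⟩ := h.exists_sum_proj a
  rw [hs]
  exact Finset.sum_eq_zero fun g _ => ha g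

/-- A property of elements closed under addition holds if it holds for homogeneous elements. -/
lemma induction_homogeneous {p : A → Prop} (zero : p 0) (add : ∀ a b, p a → p b → p (a + b))
    (mem : ∀ g, ∀ a ∈ 𝒜 g, p a) (a : A) : p a := by
  classical
  obtain ⟨s, hs⟩ := h.exists_sum_proj a
  rw [hs]
  exact Finset.sum_induction _ p add zero fun g _ => mem g _ (h.proj_mem g a)

lemma degree_unique {g k : G} {a : A} (ha : a ∈ 𝒜 g) (ha' : a ∈ 𝒜 k) (h0 : a ≠ 0) : g = k := by
  by_contra hgk
  exact h0 (by rw [← h.proj_of_mem ha', h.proj_of_mem_of_ne ha hgk])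

lemma proj_mul_left {g : G} {a : A} (ha : a ∈ 𝒜 g) (k : G) (b : A) :
    h.proj (g * k) (a * b) = a * h.proj k b := by
  induction b using h.induction_homogeneous with
  | zero => simp
  | add b c hb hc => rw [mul_add, map_add, hb, hc, map_add, mul_add]
  | mem l b hb =>
    by_cases hlk : l = k
    · subst hlk
      rw [h.proj_of_mem (h.mul_mem _ _ _ _ ha hb), h.proj_of_mem hb]
    · rw [h.proj_of_mem_of_ne hb hlk, mul_zero,
        h.proj_of_mem_of_ne (h.mul_mem _ _ _ _ ha hb) (by simpa using hlk)]

lemma proj_mul_right {g : G} {a : A} (ha : a ∈ 𝒜 g) (k : G) (b : A) :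
    h.proj (k * g) (b * a) = h.proj k b * a := by
  induction b using h.induction_homogeneous with
  | zero => simp
  | add b c hb hc => rw [add_mul, map_add, hb, hc, map_add, add_mul]
  | mem l b hb =>
    by_cases hlk : l = k
    · subst hlk
      rw [h.proj_of_mem (h.mul_mem _ _ _ _ hb ha), h.proj_of_mem hb]
    · rw [h.proj_of_mem_of_ne hb hlk, zero_mul,
        h.proj_of_mem_of_ne (h.mul_mem _ _ _ _ hb ha) (by simpa using hlk)]

/-- Comparing components of degree g in 1 * a = a, for a of degree g, shows that the degree-one part
of 1 is already a left identity. -/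
lemma one_mem : (1 : A) ∈ 𝒜 1 := by
  have key : ∀ a : A, h.proj 1 1 * a = a := by
    intro a
    induction a using h.induction_homogeneous with
    | zero => simp
    | add b c hb hc => rw [mul_add, hb, hc]
    | mem g a ha =>
      rw [← h.proj_mul_right ha, one_mul, one_mul, h.proj_of_mem ha]
  rw [← key 1, mul_one]
  exact h.proj_mem 1 1

lemma pow_mem {g : G} {a : A} (ha : a ∈ 𝒜 g) (n : ℕ) : a ^ n ∈ 𝒜 (g ^ n) := by
  induction n with
  | zero => simpa using h.one_mem
  | succ n ih => simpa [pow_succ] using h.mul_mem _ _ _ _ ih ha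

lemma proj_corner {e f : A} (he : e ∈ 𝒜 1) (hf : f ∈ 𝒜 1) (g : G) (a : A) :
    h.proj g (e * a * f) = e * h.proj g a * f := by
  have h1 := h.proj_mul_right hf g (e * a)
  have h2 := h.proj_mul_left he g a
  rw [mul_one] at h1
  rw [one_mul] at h2
  rw [h1, h2]

/-- The component of the identity, as a subalgebra. -/
def oneSubalgebra : Subalgebra F A where
  carrier := 𝒜 1
  mul_mem' ha hb := by simpa using h.mul_mem _ _ _ _ ha hb
  add_mem' ha hb := add_mem ha hb
  algebraMap_mem' c := by
    rw [Algebra.algebraMap_eq_smul_one]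
    exact Submodule.smul_mem _ c h.one_mem

/-- In a finite-dimensional graded algebra, the degree of a homogeneous element which is not
nilpotent has finite order. -/
lemma isOfFinOrder_of_not_isNilpotent [FiniteDimensional F A] {g : G} {a : A} (ha : a ∈ 𝒜 g)
    (hn : ¬ IsNilpotent a) : IsOfFinOrder g := by
  classical
  -- Finite dimension leaves finitely many nonzero components, while every power of a lies in one of
  -- them; so the powers of g cannot all be distinct.
  have hfin : {k | 𝒜 k ≠ ⊥}.Finite :=
    WellFoundedGT.finite_ne_bot_of_iSupIndep h.isInternal.submodule_iSupIndep
  have hmem : ∀ n : ℕ, g ^ n ∈ {k | 𝒜 k ≠ ⊥} := fun n hbot => hn ⟨n, by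
    have := h.pow_mem ha n
    rwa [hbot, Submodule.mem_bot] at this⟩
  by_contra hinf
  exact Set.infinite_of_injective_forall_mem (injective_pow_iff_not_isOfFinOrder.mpr hinf) hmem hfin

/-- A subspace stable under the projections inherits the grading. -/
lemma isInternal_comap_subtype (N : Submodule F A) (hN : ∀ g, ∀ a ∈ N, h.proj g a ∈ N) :
    open scoped Classical in DirectSum.IsInternal fun g => (𝒜 g).comap N.subtype := by
  classical
  rw [DirectSum.isInternal_submodule_iff_iSupIndep_and_iSup_eq_top]
  constructor
  · rw [iSupIndep_def]
    intro g
    rw [Submodule.disjoint_def]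
    intro x hx hx'
    have : ⨆ (k) (_ : k ≠ g), (𝒜 k).comap N.subtype ≤
        LinearMap.ker (h.proj g ∘ₗ N.subtype) := by
      refine iSup₂_le fun k hk y hy => ?_
      exact h.proj_of_mem_of_ne hy hk
    have h0 : h.proj g x = 0 := this hx'
    rw [h.proj_of_mem (show (x : A) ∈ 𝒜 g from hx)] at h0
    exact Subtype.ext h0
  · rw [eq_top_iff]
    intro x _
    obtain ⟨s, hs⟩ := h.exists_sum_proj (x : A)
    have : x = ∑ g ∈ s, (⟨h.proj g x, hN g x x.2⟩ : N) := by
      apply Subtype.ext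
      rw [AddSubmonoidClass.coe_finsetSum]
      exact hs
    rw [this]
    exact sum_mem fun g _ => Submodule.mem_iSup_of_mem g (h.proj_mem g x)

end IsGroupGrading
end

/-! ### The incidence algebra: its radical and its regular trace. -/

noncomputable section

namespace IncidenceAlgebra

variable {F X : Type*} [Field F] [PartialOrder X] [LocallyFiniteOrder X] [DecidableEq X]

omit [DecidableEq X] in
lemma mul_apply_self (f g : IncidenceAlgebra F X) (x : X) : (f * g) x x = f x x * g x x := by
  simp

/-- The diagonal of an element of the incidence algebra, as an algebra homomorphism. -/
def diagHom (F X : Type*) [Field F] [PartialOrder X] [LocallyFiniteOrder X] [DecidableEq X] :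
    IncidenceAlgebra F X →ₐ[F] (X → F) where
  toFun f x := f x x
  map_one' := by ext; simp
  map_mul' f g := by ext x; exact mul_apply_self f g x
  map_zero' := rfl
  map_add' _ _ := rfl
  commutes' c := by ext x; simp [Algebra.algebraMap_eq_smul_one, constSMul_apply]

@[simp] lemma diagHom_apply (f : IncidenceAlgebra F X) (x : X) : diagHom F X f x = f x x := rfl

/-- Evaluation at a pair, as a linear map. -/
def evalLM (x y : X) : IncidenceAlgebra F X →ₗ[F] F where
  toFun f := f x y
  map_add' _ _ := rfl
  map_smul' _ _ := rfl

omit [LocallyFiniteOrder X] [DecidableEq X] in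
lemma sum_apply {ι : Type*} (s : Finset ι) (f : ι → IncidenceAlgebra F X) (x y : X) :
    (∑ i ∈ s, f i) x y = ∑ i ∈ s, f i x y := map_sum (evalLM x y) f s

/-- The diagonal matrix unit at `x`. -/
def diagUnit (F : Type*) {X : Type*} [Field F] [PartialOrder X] [DecidableEq X] (x : X) :
    IncidenceAlgebra F X :=
  ⟨fun a b => if a = x ∧ b = x then 1 else 0, fun _ _ hab => if_neg fun h =>
    hab (h.1.trans h.2.symm).le⟩

omit [LocallyFiniteOrder X] in
lemma diagUnit_apply (x a b : X) :
    diagUnit F x a b = if a = x ∧ b = x then 1 else 0 := rfl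

lemma diagUnit_mul_apply (x a b : X) (f : IncidenceAlgebra F X) :
    (diagUnit F x * f) a b = if a = x then f a b else 0 := by
  rw [mul_apply]
  split_ifs with h
  · subst h
    by_cases hab : a ≤ b
    · rw [Finset.sum_eq_single a]
      · simp [diagUnit_apply]
      · intro z _ hz; simp [diagUnit_apply, hz]
      · intro ha; simp [hab] at ha
    · rw [apply_eq_zero_of_not_le hab, Finset.Icc_eq_empty hab, Finset.sum_empty]
  · exact Finset.sum_eq_zero fun z _ => by simp [diagUnit_apply, h]

lemma mul_diagUnit_apply (x a b : X) (f : IncidenceAlgebra F X) :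
    (f * diagUnit F x) a b = if b = x then f a b else 0 := by
  rw [mul_apply]
  split_ifs with h
  · subst h
    by_cases hab : a ≤ b
    · rw [Finset.sum_eq_single b]
      · simp [diagUnit_apply]
      · intro z _ hz; simp [diagUnit_apply, hz]
      · intro ha; simp [hab] at ha
    · rw [apply_eq_zero_of_not_le hab, Finset.Icc_eq_empty hab, Finset.sum_empty]
  · exact Finset.sum_eq_zero fun z _ => by simp [diagUnit_apply, h]

section Finite

variable [Finite X]

/-- The number of elements strictly below `x`. -/
def belowCard (x : X) : ℕ := (Set.Iio x).ncard

omit [LocallyFiniteOrder X] [DecidableEq X] in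
lemma belowCard_strictMono : StrictMono (belowCard : X → ℕ) := fun x y hxy =>
  Set.ncard_lt_ncard ⟨Set.Iio_subset_Iio hxy.le, fun h => lt_irrefl x (h hxy)⟩

/-- A nonzero entry of the n-th power needs a strict chain of n steps from x to y, and each step
raises the rank. -/
lemma belowCard_add_le_of_pow_ne_zero {f : IncidenceAlgebra F X} (hf : diagHom F X f = 0) (n : ℕ)
    {x y : X} (h : (f ^ n) x y ≠ 0) : belowCard x + n ≤ belowCard y := by
  induction n generalizing y with
  | zero =>
    simp only [pow_zero, one_apply, ne_eq, ite_eq_right_iff, one_ne_zero, imp_false,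
      not_not] at h
    simp [h]
  | succ n ih =>
    rw [pow_succ, mul_apply] at h
    obtain ⟨z, -, hz⟩ := Finset.exists_ne_zero_of_sum_ne_zero h
    have h1 := ih (left_ne_zero_of_mul hz)
    have h2 := right_ne_zero_of_mul hz
    have hzy : z < y := lt_of_le_of_ne (le_of_ne_zero h2) fun hzy => h2 (by
      subst hzy; exact congrFun hf z)
    have := belowCard_strictMono hzy
    omega

lemma isNilpotent_of_diagHom_eq_zero {f : IncidenceAlgebra F X} (hf : diagHom F X f = 0) :
    IsNilpotent f := by
  refine ⟨Nat.card X + 1, ?_⟩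
  ext x y _
  by_contra h
  have h1 := belowCard_add_le_of_pow_ne_zero hf _ h
  have h2 : belowCard y ≤ Nat.card X := Set.ncard_le_card _
  omega

omit [Finite X] in
lemma diagHom_eq_zero_of_isNilpotent {f : IncidenceAlgebra F X} (hf : IsNilpotent f) :
    diagHom F X f = 0 := (hf.map (diagHom F X)).eq_zero

/-- The incidence algebra as the space of functions on the set of comparable pairs. -/
def pairEquiv (F X : Type*) [Field F] [PartialOrder X] [LocallyFiniteOrder X] [DecidableEq X] :
    IncidenceAlgebra F X ≃ₗ[F] ({p : X × X // p.1 ≤ p.2} → F) where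
  toFun f p := f p.1.1 p.1.2
  map_add' _ _ := rfl
  map_smul' _ _ := rfl
  invFun φ := by
    classical
    exact ⟨fun a b => if h : a ≤ b then φ ⟨(a, b), h⟩ else 0, fun a b h => dif_neg h⟩
  left_inv f := by
    ext a b hab
    simp [hab]
  right_inv φ := by
    ext ⟨⟨a, b⟩, hab⟩
    exact dif_pos hab

instance : FiniteDimensional F (IncidenceAlgebra F X) :=
  Module.Finite.equiv (pairEquiv F X).symm

lemma finrank_eq : Module.finrank F (IncidenceAlgebra F X) =
    Nat.card {p : X × X // p.1 ≤ p.2} := by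
  classical
  have := Fintype.ofFinite {p : X × X // p.1 ≤ p.2}
  rw [(pairEquiv F X).finrank_eq, Module.finrank_fintype_fun_eq_card, Nat.card_eq_fintype_card]

/-- Bounds the multiplicities in the regular trace, so that they stay nonzero in F when the
characteristic exceeds the dimension. -/
lemma ncard_Ici_le_finrank (x : X) :
    (Set.Ici x).ncard ≤ Module.finrank F (IncidenceAlgebra F X) := by
  rw [finrank_eq]
  exact Nat.card_le_card_of_injective
    (fun y : Set.Ici x => (⟨(x, y.1), y.2⟩ : {p : X × X // p.1 ≤ p.2}))
    fun y z hyz => Subtype.ext (congrArg (fun p => p.1.2) hyz)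

/-- The trace of the regular representation. -/
def regularTrace (F X : Type*) [Field F] [PartialOrder X] [LocallyFiniteOrder X]
    [DecidableEq X] : IncidenceAlgebra F X →ₗ[F] F :=
  LinearMap.trace F _ ∘ₗ LinearMap.mul F (IncidenceAlgebra F X)

/-- In the basis of matrix units, left multiplication by f has diagonal entry f x x at each pair (x,
y), and there are as many such pairs as points y above x. -/
lemma regularTrace_apply [Fintype X] (f : IncidenceAlgebra F X) :
    regularTrace F X f = ∑ x, (Set.Ici x).ncard * f x x := by
  classical
  let b := Module.Basis.ofEquivFun (pairEquiv F X)
  rw [regularTrace, LinearMap.comp_apply, LinearMap.trace_eq_matrix_trace F b, Matrix.trace]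
  have hdiag : ∀ p : {p : X × X // p.1 ≤ p.2},
      (LinearMap.toMatrix b b (LinearMap.mul F _ f)).diag p = f p.1.1 p.1.1 := by
    rintro ⟨⟨x, y⟩, hxy⟩
    rw [Matrix.diag_apply, LinearMap.toMatrix_apply]
    change (f * b ⟨(x, y), hxy⟩) x y = f x x
    have hb : ∀ z, b ⟨(x, y), hxy⟩ z y = if z = x then 1 else 0 := by
      intro z
      rw [Module.Basis.coe_ofEquivFun]
      change (if h : z ≤ y then _ else 0) = _
      split_ifs with h1 h2 h2
      · subst h2; simp
      · rw [Pi.single_apply, if_neg]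
        simpa using h2
      · exact absurd (h2 ▸ hxy) h1
      · rfl
    rw [mul_apply, Finset.sum_eq_single x]
    · simp [hb]
    · intro z _ hz; simp [hb, hz]
    · intro h; simp [hxy] at h
  simp only [hdiag]
  have hsum : ∑ p : {p : X × X // p.1 ≤ p.2}, f p.1.1 p.1.1 =
      ∑ p : X × X with p.1 ≤ p.2, f p.1 p.1 :=
    (Finset.sum_subtype _ (by simp) fun p : X × X => f p.1 p.1).symm
  rw [hsum, Finset.sum_filter, Fintype.sum_prod_type]
  refine Finset.sum_congr rfl fun x _ => ?_
  rw [← Finset.sum_filter]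
  simp only
  rw [Finset.sum_const, nsmul_eq_mul, Set.ncard_eq_toFinset_card']
  congr 3
  ext; simp

end Finite

end IncidenceAlgebra

/-! ### The radical is graded. -/

namespace IsGroupGrading

open IncidenceAlgebra

variable {F X G : Type*} [Field F] [PartialOrder X] [Finite X] [LocallyFiniteOrder X]
  [DecidableEq X] [Group G] {𝒜 : G → Submodule F (IncidenceAlgebra F X)}

-- When degrees commute, the commutator of two homogeneous elements is homogeneous, so each of its
-- projections is itself or zero; and all commutators have zero diagonal.
omit [Finite X] in
lemma diagHom_proj_commutator (h : IsGroupGrading 𝒜) (hG : ∀ a b : G, a * b = b * a) (k : G)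
    (a b : IncidenceAlgebra F X) : diagHom F X (h.proj k (a * b - b * a)) = 0 := by
  induction a using h.induction_homogeneous with
  | zero => simp
  | add a a' ha ha' =>
    rw [show (a + a') * b - b * (a + a') = (a * b - b * a) + (a' * b - b * a') by noncomm_ring,
      map_add, map_add, ha, ha', add_zero]
  | mem g a ha =>
    induction b using h.induction_homogeneous with
    | zero => simp
    | add b b' hb hb' =>
      rw [show a * (b + b') - (b + b') * a = (a * b - b * a) + (a * b' - b' * a) by noncomm_ring,
        map_add, map_add, hb, hb', add_zero]
    | mem l b hb =>
      have hmem : a * b - b * a ∈ 𝒜 (g * l) :=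
        sub_mem (h.mul_mem _ _ _ _ ha hb) (hG l g ▸ h.mul_mem _ _ _ _ hb ha)
      by_cases hk : g * l = k
      · subst hk
        rw [h.proj_of_mem hmem, map_sub, map_mul, map_mul, mul_comm, sub_self]
      · rw [h.proj_of_mem_of_ne hmem hk, map_zero]

lemma diagHom_proj_of_comm (h : IsGroupGrading 𝒜) (hG : ∀ a b : G, a * b = b * a) (k : G)
    {f : IncidenceAlgebra F X} (hf : diagHom F X f = 0) : diagHom F X (h.proj k f) = 0 := by
  have := Fintype.ofFinite X
  -- For x ≠ y the entry e_x f e_y is the commutator of e_x with itself, because e_y e_x = 0.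
  have hsum : f = ∑ x, ∑ y, if x = y then 0 else
      (diagUnit F x * (diagUnit F x * f * diagUnit F y) -
        (diagUnit F x * f * diagUnit F y) * diagUnit F x) := by
    ext a b _
    rw [IncidenceAlgebra.sum_apply]
    simp only [IncidenceAlgebra.sum_apply]
    rw [Finset.sum_eq_single a, Finset.sum_eq_single b]
    · split_ifs with hab
      · subst hab; exact congrFun hf a
      · simp [IncidenceAlgebra.sub_apply, diagUnit_mul_apply, mul_diagUnit_apply, Ne.symm hab,
          -IncidenceAlgebra.mul_apply]
    · intro y _ hy
      split_ifs with hay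
      · rfl
      · simp [IncidenceAlgebra.sub_apply, diagUnit_mul_apply, mul_diagUnit_apply, Ne.symm hy,
          -IncidenceAlgebra.mul_apply]
    · simp
    · intro x _ hx
      refine Finset.sum_eq_zero fun y _ => ?_
      split_ifs with hay
      · rfl
      · simp [IncidenceAlgebra.sub_apply, mul_assoc, diagUnit_mul_apply, Ne.symm hx,
          -IncidenceAlgebra.mul_apply]
    · simp
  rw [hsum]
  simp only [map_sum]
  refine Finset.sum_eq_zero fun x _ => Finset.sum_eq_zero fun y _ => ?_
  split_ifs
  · simp
  · exact h.diagHom_proj_commutator hG k _ _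

/-- Left multiplication by a moves every component to a different one, so no diagonal block
contributes. -/
lemma regularTrace_of_mem (h : IsGroupGrading 𝒜) {g : G} (hg : g ≠ 1) {a : IncidenceAlgebra F X}
    (ha : a ∈ 𝒜 g) : regularTrace F X a = 0 := by
  classical
  exact LinearMap.trace_eq_zero_of_mapsTo_ne h.isInternal (fun k => g * k) (by simpa using hg)
    fun k b hb => h.mul_mem _ _ _ _ ha hb

lemma regularTrace_proj_one (h : IsGroupGrading 𝒜) (a : IncidenceAlgebra F X) :
    regularTrace F X (h.proj 1 a) = regularTrace F X a := by
  induction a using h.induction_homogeneous with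
  | zero => simp
  | add a b ha hb => simp only [map_add, ha, hb]
  | mem g a ha =>
    by_cases hg : g = 1
    · subst hg; rw [h.proj_of_mem ha]
    · rw [h.proj_of_mem_of_ne ha hg, h.regularTrace_of_mem hg ha, map_zero]

lemma diagHom_proj_of_char (h : IsGroupGrading 𝒜)
    (hF : ringChar F = 0 ∨ Module.finrank F (IncidenceAlgebra F X) < ringChar F) (k : G)
    {f : IncidenceAlgebra F X} (hf : diagHom F X f = 0) : diagHom F X (h.proj k f) = 0 := by
  have := Fintype.ofFinite X
  -- Orthogonality to J passes to components: for b of degree l, the trace vanishes by degree unless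
  -- k * l = 1. In that case it is the trace of f * b, whose diagonal is zero.
  have key : ∀ b, regularTrace F X (h.proj k f * b) = 0 := by
    intro b
    induction b using h.induction_homogeneous with
    | zero => simp
    | add b c hb hc => rw [mul_add, map_add, hb, hc, add_zero]
    | mem l b hb =>
      by_cases hkl : k * l = 1
      · rw [← h.proj_mul_right hb, hkl, h.regularTrace_proj_one, regularTrace_apply]
        refine Finset.sum_eq_zero fun x _ => ?_
        rw [mul_apply_self, show f x x = 0 from congrFun hf x, zero_mul, mul_zero]
      · exact h.regularTrace_of_mem hkl (h.mul_mem _ _ _ _ (h.proj_mem k f) hb)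
  ext x
  -- Testing against the unit at x isolates the x-th diagonal value, multiplied by the number of
  -- points above x.
  have hx := key (diagUnit F x)
  rw [regularTrace_apply, Finset.sum_eq_single x] at hx
  · rw [mul_apply_self] at hx
    simp only [diagUnit_apply, and_self, if_true, mul_one] at hx
    rcases mul_eq_zero.mp hx with h0 | h0
    · exfalso
      have hdvd := (ringChar.spec F _).mp h0
      have hpos : 0 < (Set.Ici x).ncard := (Set.ncard_pos).mpr ⟨x, le_rfl⟩
      have hle := ncard_Ici_le_finrank (F := F) x
      have hle' := Nat.le_of_dvd hpos hdvd
      rcases hF with hF | hF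
      · rw [hF] at hdvd; simp at hdvd; omega
      · omega
    · exact h0
  · intro y _ hy
    rw [mul_apply_self]; simp [diagUnit_apply, hy]
  · simp

/-- If the characteristic is zero or large, or the group is abelian, then the radical of the
incidence algebra is graded. -/
lemma diagHom_proj (h : IsGroupGrading 𝒜)
    (hFG : ringChar F = 0 ∨ Module.finrank F (IncidenceAlgebra F X) < ringChar F ∨
      ∀ a b : G, a * b = b * a) (k : G)
    {f : IncidenceAlgebra F X} (hf : diagHom F X f = 0) : diagHom F X (h.proj k f) = 0 := by
  rcases hFG with hF | hF | hG
  · exact h.diagHom_proj_of_char (.inl hF) k hf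
  · exact h.diagHom_proj_of_char (.inr hF) k hf
  · exact h.diagHom_proj_of_comm hG k hf

end IsGroupGrading
end

/-! ### Homogeneous idempotents and the order of the classes. -/

noncomputable section

open IncidenceAlgebra

/-- In a subalgebra of functions on a finite set, the points which are separated from a given
point can be simultaneously separated from it. -/
lemma Subalgebra.exists_eq_one_and_eq_zero {F X : Type*} [Field F] [Finite X]
    (R : Subalgebra F (X → F)) (x : X) :
    ∃ r ∈ R, r x = 1 ∧ ∀ y, (∃ s ∈ R, s x ≠ s y) → r y = 0 := by
  classical
  have := Fintype.ofFinite X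
  have key : ∀ y, ∃ r ∈ R, r x = 1 ∧ ((∃ s ∈ R, s x ≠ s y) → r y = 0) := by
    intro y
    by_cases hy : ∃ s ∈ R, s x ≠ s y
    · obtain ⟨s, hs, hxy⟩ := hy
      -- Linear interpolation gives 1 at x and 0 at y; the product over all y then treats all
      -- separated points at once.
      refine ⟨(s x - s y)⁻¹ • (s - algebraMap F (X → F) (s y)),
        R.smul_mem (R.sub_mem hs (R.algebraMap_mem _)) _, ?_, fun _ => ?_⟩
      · simp [inv_mul_cancel₀ (sub_ne_zero.mpr hxy)]
      · simp
    · exact ⟨1, R.one_mem, rfl, fun h => absurd h hy⟩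
  choose r hr hrx hry using key
  refine ⟨∏ y, r y, R.prod_mem fun y _ => hr y, ?_, fun y hy => ?_⟩
  · rw [Finset.prod_apply]
    exact Finset.prod_eq_one fun y _ => hrx y
  · rw [Finset.prod_apply]
    exact Finset.prod_eq_zero (Finset.mem_univ y) (hry y hy)

/-- A complete system of orthogonal idempotents of degree one in a graded incidence algebra, lifting
the primitive idempotents of the diagonal part of the component of degree one. The map `cls` sends
`x` to the index of the idempotent whose diagonal is supported at `x`. -/
structure IsHomogeneousFrame {F X G ι : Type*} [Field F] [PartialOrder X]
    [LocallyFiniteOrder X] [DecidableEq X] [Group G] [Fintype ι] [DecidableEq ι]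
    (𝒜 : G → Submodule F (IncidenceAlgebra F X)) (e : ι → IncidenceAlgebra F X)
    (cls : X → ι) : Prop where
  complete : CompleteOrthogonalIdempotents e
  mem : ∀ i, e i ∈ 𝒜 1
  apply_self : ∀ i x, e i x x = if cls x = i then 1 else 0
  const : ∀ a ∈ 𝒜 1, ∀ x y, cls x = cls y → a x x = a y y
  surjective : Function.Surjective cls

lemma IsGroupGrading.exists_isHomogeneousFrame {F : Type u} {X : Type v} {G : Type w} [Field F]
    [PartialOrder X] [Finite X] [LocallyFiniteOrder X] [DecidableEq X] [Group G]
    {𝒜 : G → Submodule F (IncidenceAlgebra F X)} (h : IsGroupGrading 𝒜) :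
    ∃ (t : ℕ) (e : Fin t → IncidenceAlgebra F X) (cls : X → Fin t),
      IsHomogeneousFrame 𝒜 e cls := by
  classical
  have := Fintype.ofFinite X
  let R : Subalgebra F (X → F) := h.oneSubalgebra.map (diagHom F X)
  -- Two points are equivalent when no diagonal of a degree-one element separates them; this makes
  -- the field `const` automatic.
  let S : Setoid X :=
    { r := fun x y => ∀ r ∈ R, r x = r y
      iseqv := ⟨fun _ _ _ => rfl, fun h r hr => (h r hr).symm,
        fun h h' r hr => (h r hr).trans (h' r hr)⟩ }
  let q := Finite.equivFin (Quotient S)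
  let cls : X → Fin (Nat.card (Quotient S)) := fun x => q ⟦x⟧
  have hcls : ∀ x y, cls x = cls y ↔ ∀ r ∈ R, r x = r y := fun x y =>
    q.injective.eq_iff.trans Quotient.eq
  have hsurj : Function.Surjective cls := q.surjective.comp Quotient.mk_surjective
  let ε : Fin (Nat.card (Quotient S)) → X → F := fun i x => if cls x = i then 1 else 0
  have hε : CompleteOrthogonalIdempotents ε := by
    refine ⟨⟨fun i => ?_, fun i j hij => ?_⟩, ?_⟩
    · ext x; simp [ε]
    · ext x; simp only [ε, Pi.mul_apply, Pi.zero_apply]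
      split_ifs with h1 h2
      · exact absurd (h1.symm.trans h2) hij
      all_goals simp
    · ext x; simp [ε, Finset.sum_apply]
  have hεR : ∀ i, ε i ∈ R := by
    intro i
    obtain ⟨x, rfl⟩ := hsurj i
    obtain ⟨r, hr, hrx, hry⟩ := R.exists_eq_one_and_eq_zero x
    convert hr
    ext y
    simp only [ε]
    split_ifs with hy
    · rw [← hrx]; exact ((hcls _ _).mp hy r hr).symm
    · refine (hry y ?_).symm
      by_contra hcon
      push Not at hcon
      exact hy ((hcls _ _).mpr fun s hs => (hcon s hs).symm)
  let f : h.oneSubalgebra →+* (X → F) := ((diagHom F X).comp h.oneSubalgebra.val).toRingHom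
  -- Lifting takes place inside the degree-one subalgebra, so the idempotents obtained are
  -- homogeneous.
  obtain ⟨e, he, hfe⟩ := CompleteOrthogonalIdempotents.lift_of_isNilpotent_ker f
    (fun a ha => by
      have h1 : diagHom F X a = 0 := ha
      obtain ⟨n, hn⟩ := isNilpotent_of_diagHom_eq_zero h1
      exact ⟨n, Subtype.ext hn⟩) hε
    (fun i => by
      obtain ⟨a, ha, hai⟩ := hεR i
      exact ⟨⟨a, ha⟩, hai⟩)
  refine ⟨_, fun i => e i, cls, he.map h.oneSubalgebra.val.toRingHom, fun i => (e i).2,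
    fun i x => congrFun (congrFun hfe i) x, fun a ha x y hxy => ?_, hsurj⟩
  exact (hcls x y).mp hxy (diagHom F X a) ⟨a, ha, rfl⟩

namespace IsHomogeneousFrame

variable {F X G ι : Type*} [Field F] [PartialOrder X] [Finite X]
    [LocallyFiniteOrder X] [DecidableEq X] [Group G] [Fintype ι] [DecidableEq ι]
    {𝒜 : G → Submodule F (IncidenceAlgebra F X)} {e : ι → IncidenceAlgebra F X}
    {cls : X → ι}

omit [Finite X] in
lemma reindex {κ : Type*} [Fintype κ] [DecidableEq κ] (hf : IsHomogeneousFrame 𝒜 e cls)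
    (σ : κ ≃ ι) : IsHomogeneousFrame 𝒜 (e ∘ σ) (σ.symm ∘ cls) where
  complete := (CompleteOrthogonalIdempotents.equiv σ).mpr hf.complete
  mem i := hf.mem _
  apply_self i x := by simp [hf.apply_self, Equiv.symm_apply_eq]
  const a ha x y hxy := hf.const a ha x y (by simpa using hxy)
  surjective := σ.symm.surjective.comp hf.surjective

omit [Finite X] in
lemma idem (hf : IsHomogeneousFrame 𝒜 e cls) (i : ι) : e i * e i = e i := hf.complete.idem i

omit [Finite X] in
lemma mul_of_corner (hf : IsHomogeneousFrame 𝒜 e cls) {i j : ι} {a : IncidenceAlgebra F X}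
    (ha : e i * a * e j = a) : e i * a = a := by
  rw [← ha, ← mul_assoc, ← mul_assoc, hf.idem]

omit [Finite X] in
lemma of_corner_mul (hf : IsHomogeneousFrame 𝒜 e cls) {i j : ι} {a : IncidenceAlgebra F X}
    (ha : e i * a * e j = a) : a * e j = a := by
  rw [← ha, mul_assoc, hf.idem]

omit [Finite X] in
lemma corner_proj (hf : IsHomogeneousFrame 𝒜 e cls) (h : IsGroupGrading 𝒜) {i j : ι}
    {a : IncidenceAlgebra F X} (ha : e i * a * e j = a) (g : G) :
    e i * h.proj g a * e j = h.proj g a := by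
  rw [← h.proj_corner (hf.mem i) (hf.mem j), ha]

omit [Finite X] in
lemma corner_mul (hf : IsHomogeneousFrame 𝒜 e cls) {i j k : ι} {a b : IncidenceAlgebra F X}
    (ha : e i * a * e j = a) (hb : e j * b * e k = b) : e i * (a * b) * e k = a * b := by
  rw [← mul_assoc, hf.mul_of_corner ha, mul_assoc, hf.of_corner_mul hb]

omit [Finite X] in
lemma corner_idem (hf : IsHomogeneousFrame 𝒜 e cls) (i : ι) : e i * e i * e i = e i := by
  rw [hf.idem, hf.idem]

omit [Finite X] in
lemma corner_pow (hf : IsHomogeneousFrame 𝒜 e cls) {i : ι} {a : IncidenceAlgebra F X}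
    (ha : e i * a * e i = a) {n : ℕ} (hn : 0 < n) : e i * a ^ n * e i = a ^ n := by
  obtain ⟨m, rfl⟩ := Nat.exists_eq_succ_of_ne_zero hn.ne'
  clear hn
  induction m with
  | zero => simpa using ha
  | succ m ih => rw [pow_succ]; exact hf.corner_mul ih ha

omit [Finite X] in
lemma apply_self_of_corner (hf : IsHomogeneousFrame 𝒜 e cls) {i j : ι}
    {a : IncidenceAlgebra F X} (ha : e i * a * e j = a) {x : X} (hx : cls x ≠ i ∨ cls x ≠ j) :
    a x x = 0 := by
  rw [← ha, mul_apply_self, mul_apply_self, hf.apply_self, hf.apply_self]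
  rcases hx with hx | hx <;> simp [hx]

/-- A homogeneous element of a diagonal corner with nonzero diagonal has a power which is a nonzero
multiple of the idempotent modulo the radical. -/
lemma exists_pow (hf : IsHomogeneousFrame 𝒜 e cls) (h : IsGroupGrading 𝒜) {i : ι} {g : G}
    {c : IncidenceAlgebra F X} (hc : e i * c * e i = c) (hcg : c ∈ 𝒜 g)
    (hc0 : diagHom F X c ≠ 0) :
    ∃ n > 0, g ^ n = 1 ∧ ∃ r : F, r ≠ 0 ∧ diagHom F X (c ^ n - r • e i) = 0 := by
  have hnil : ¬ IsNilpotent c := fun hn => hc0 (diagHom_eq_zero_of_isNilpotent hn)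
  obtain ⟨n, hn, hgn⟩ := isOfFinOrder_iff_pow_eq_one.mp (h.isOfFinOrder_of_not_isNilpotent hcg hnil)
  -- Having degree one, this power has constant diagonal on class i; its value there is the scalar
  -- r.
  have hmem : c ^ n ∈ 𝒜 1 := hgn ▸ h.pow_mem hcg n
  obtain ⟨x, hx⟩ : ∃ x, c x x ≠ 0 := by
    by_contra! hcon
    exact hc0 (funext hcon)
  have hpow : ∀ y, (c ^ n) y y = c y y ^ n := fun y => by
    simpa using congrFun (map_pow (diagHom F X) c n) y
  have hxi : cls x = i := by
    by_contra hxi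
    exact hx (hf.apply_self_of_corner hc (.inl hxi))
  refine ⟨n, hn, hgn, c x x ^ n, pow_ne_zero n hx, ?_⟩
  ext y
  rw [diagHom_apply, IncidenceAlgebra.sub_apply, constSMul_apply, hf.apply_self]
  split_ifs with hy
  · rw [hf.const _ hmem y x (hy.trans hxi.symm), hpow]
    simp
  · rw [hf.apply_self_of_corner (hf.corner_pow hc hn) (.inl hy)]
    simp

/-- Since a is homogeneous, each component of c also kills a. If one had nonzero diagonal, a power
of it would be r • e i plus a nilpotent, and a would be an eigenvector of that nilpotent with
eigenvalue -r ≠ 0. -/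
lemma diagHom_eq_zero_of_mul_eq_zero (hf : IsHomogeneousFrame 𝒜 e cls) (h : IsGroupGrading 𝒜)
    {i : ι} {k : G} {a c : IncidenceAlgebra F X} (hia : e i * a = a) (hak : a ∈ 𝒜 k) (ha0 : a ≠ 0)
    (hc : e i * c * e i = c) (hca : c * a = 0) : diagHom F X c = 0 := by
  have key : ∀ g, diagHom F X (h.proj g c) = 0 := by
    intro g
    by_contra hne
    obtain ⟨n, hn, -, r, hr, hdiag⟩ := hf.exists_pow h (hf.corner_proj h hc g) (h.proj_mem g c) hne
    have hca' : h.proj g c * a = 0 := by rw [← h.proj_mul_right hak, hca, map_zero]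
    obtain ⟨m, hm⟩ := isNilpotent_of_diagHom_eq_zero hdiag
    have hj : (h.proj g c ^ n - r • e i) * a = (-r) • a := by
      obtain ⟨n, rfl⟩ := Nat.exists_eq_succ_of_ne_zero hn.ne'
      rw [sub_mul, pow_succ, mul_assoc, hca', mul_zero, smul_mul_assoc, hia, zero_sub, neg_smul]
    have hjm : ∀ m : ℕ, (h.proj g c ^ n - r • e i) ^ m * a = (-r) ^ m • a := by
      intro m
      induction m with
      | zero => simp
      | succ m ih => rw [pow_succ, mul_assoc, hj, mul_smul_comm, ih, smul_smul, ← pow_succ']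
    have := hjm m
    rw [hm, zero_mul, eq_comm, smul_eq_zero] at this
    exact this.elim (pow_ne_zero _ (neg_ne_zero.mpr hr)) ha0
  obtain ⟨s, hs⟩ := h.exists_sum_proj c
  rw [hs, map_sum]
  exact Finset.sum_eq_zero fun g _ => key g

/-- If the radical meets the corner `(i, j)`, then every point of the `i`-th class is below a point
of the `j`-th class. -/
lemma exists_lt (hf : IsHomogeneousFrame 𝒜 e cls) (h : IsGroupGrading 𝒜)
    (hJ : ∀ k f, diagHom F X f = 0 → diagHom F X (h.proj k f) = 0)
    {i j : ι} {a : IncidenceAlgebra F X} (ha : e i * a * e j = a) (ha0 : a ≠ 0)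
    (had : diagHom F X a = 0) {x : X} (hx : cls x = i) : ∃ y, cls y = j ∧ x < y := by
  obtain ⟨k, hk⟩ : ∃ k, h.proj k a ≠ 0 := by
    by_contra! hcon
    exact ha0 (h.eq_zero_of_proj hcon)
  have hb := hf.corner_proj h ha k
  have hbd := hJ k a had
  have hbk := h.proj_mem k a
  set b := h.proj k a
  -- If row x vanished, the compression of the unit at x to corner i would kill b, although its
  -- diagonal value at x is 1.
  have hrow : ∃ y, b x y ≠ 0 := by
    by_contra! hcon
    have hxb : diagUnit F x * b = 0 := by
      ext z y _
      rw [diagUnit_mul_apply]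
      split_ifs with hz
      · rw [hz, hcon y]; rfl
      · rfl
    have hc : e i * (e i * diagUnit F x * e i) * e i = e i * diagUnit F x * e i := by
      rw [← mul_assoc, ← mul_assoc, hf.idem, mul_assoc, hf.idem]
    have hcb : e i * diagUnit F x * e i * b = 0 := by
      rw [mul_assoc, hf.mul_of_corner hb, mul_assoc, hxb, mul_zero]
    have h0 := congrFun (hf.diagHom_eq_zero_of_mul_eq_zero h (hf.mul_of_corner hb) hbk hk hc hcb) x
    rw [diagHom_apply, mul_apply_self, mul_apply_self, hf.apply_self, if_pos hx] at h0
    simp [diagUnit_apply] at h0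
  -- For y minimal, only z = y survives in the (x, y) entry of b * e j, so e j is nonzero at y and y
  -- lies in class j.
  obtain ⟨y, hy, hmin⟩ := WellFounded.has_min (wellFounded_lt (α := X)) {y | b x y ≠ 0} hrow
  have hxy : x ≤ y := le_of_ne_zero hy
  have hy' : b x y = b x y * e j y y := by
    conv_lhs => rw [← hf.of_corner_mul hb, mul_apply]
    refine Finset.sum_eq_single y (fun z hz hzy => ?_) (fun hn => ?_)
    · have : b x z = 0 := by
        by_contra hne
        exact hmin z hne (lt_of_le_of_ne (Finset.mem_Icc.mp hz).2 hzy)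
      rw [this, zero_mul]
    · simp [hxy] at hn
  refine ⟨y, ?_, lt_of_le_of_ne hxy fun hxy' => hy ?_⟩
  · by_contra hyj
    rw [hf.apply_self, if_neg hyj, mul_zero] at hy'
    exact hy hy'
  · rw [← hxy']
    exact congrFun hbd x

/-- The maximal rank of a point in a class. -/
def classRank (cls : X → ι) (i : ι) : ℕ := by
  classical
  exact letI := Fintype.ofFinite X; (Finset.univ.filter (cls · = i)).sup belowCard

/-- A point of maximal rank in class i lies strictly below a point of class j. -/
lemma classRank_lt (hf : IsHomogeneousFrame 𝒜 e cls) (h : IsGroupGrading 𝒜)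
    (hJ : ∀ k f, diagHom F X f = 0 → diagHom F X (h.proj k f) = 0)
    {i j : ι} {a : IncidenceAlgebra F X} (ha : e i * a * e j = a) (ha0 : a ≠ 0)
    (had : diagHom F X a = 0) : classRank cls i < classRank cls j := by
  classical
  let := Fintype.ofFinite X
  obtain ⟨x₀, hx₀⟩ := hf.surjective i
  obtain ⟨x, hx, hmax⟩ := Finset.exists_mem_eq_sup (Finset.univ.filter (cls · = i))
    ⟨x₀, by simp [hx₀]⟩ belowCard
  obtain ⟨y, hy, hxy⟩ := hf.exists_lt h hJ ha ha0 had (by simpa using hx)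
  have h1 : classRank cls i = belowCard x := by rw [← hmax, classRank]
  have h2 : belowCard y ≤ classRank cls j := by
    rw [classRank]
    exact Finset.le_sup (f := belowCard) (by simp [hy])
  rw [h1]
  exact (belowCard_strictMono hxy).trans_le h2

lemma corner_eq_zero_of_diagHom (hf : IsHomogeneousFrame 𝒜 e cls) (h : IsGroupGrading 𝒜)
    (hJ : ∀ k f, diagHom F X f = 0 → diagHom F X (h.proj k f) = 0)
    {i : ι} {a : IncidenceAlgebra F X} (ha : e i * a * e i = a)
    (had : diagHom F X a = 0) : a = 0 := by
  by_contra ha0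
  exact lt_irrefl _ (hf.classRank_lt h hJ ha ha0 had)

/-- Some power of a would otherwise be a nonzero multiple of e i modulo J, hence nonzero at every
point of the class. Thus evaluation at one point determines homogeneous elements of a diagonal
corner. -/
lemma corner_eq_zero_of_homogeneous (hf : IsHomogeneousFrame 𝒜 e cls) (h : IsGroupGrading 𝒜)
    (hJ : ∀ k f, diagHom F X f = 0 → diagHom F X (h.proj k f) = 0)
    {i : ι} {a : IncidenceAlgebra F X} (ha : e i * a * e i = a) {g : G} (hag : a ∈ 𝒜 g)
    {x : X} (hx : cls x = i) (hax : a x x = 0) : a = 0 := by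
  refine hf.corner_eq_zero_of_diagHom h hJ ha ?_
  by_contra hne
  obtain ⟨n, hn, -, r, hr, hdiag⟩ := hf.exists_pow h ha hag hne
  have h1 := congrFun hdiag x
  have h2 := congrFun (map_pow (diagHom F X) a n) x
  simp only [diagHom_apply, Pi.pow_apply, hax, zero_pow hn.ne'] at h2
  rw [diagHom_apply, IncidenceAlgebra.sub_apply, constSMul_apply, hf.apply_self, if_pos hx,
    h2] at h1
  simp [hr] at h1

end IsHomogeneousFrame

/-- There is a homogeneous frame for which the corners below the diagonal vanish. -/
lemma IsGroupGrading.exists_triangular_frame {F : Type u} {X : Type v} {G : Type w} [Field F]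
    [PartialOrder X] [Finite X] [LocallyFiniteOrder X] [DecidableEq X] [Group G]
    {𝒜 : G → Submodule F (IncidenceAlgebra F X)} (h : IsGroupGrading 𝒜)
    (hJ : ∀ k f, diagHom F X f = 0 → diagHom F X (h.proj k f) = 0) :
    ∃ (t : ℕ) (e : Fin t → IncidenceAlgebra F X) (cls : X → Fin t),
      IsHomogeneousFrame 𝒜 e cls ∧ ∀ i j, j < i → ∀ a, e i * a * e j = 0 := by
  obtain ⟨t, e, cls, hf⟩ := h.exists_isHomogeneousFrame
  let σ := Tuple.sort (IsHomogeneousFrame.classRank cls)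
  have hmono := Tuple.monotone_sort (IsHomogeneousFrame.classRank cls)
  refine ⟨t, e ∘ σ, σ.symm ∘ cls, hf.reindex σ, fun i j hij a => ?_⟩
  by_contra hne
  have hc : e (σ i) * (e (σ i) * a * e (σ j)) * e (σ j) = e (σ i) * a * e (σ j) := by
    rw [← mul_assoc, ← mul_assoc, hf.idem, mul_assoc, hf.idem]
  -- Off-diagonal corners lie in J, because distinct idempotents have disjoint diagonal supports.
  have hd : diagHom F X (e (σ i) * a * e (σ j)) = 0 := by
    ext x
    refine hf.apply_self_of_corner hc ?_
    by_contra! hcon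
    exact hij.ne' (σ.injective (hcon.1.symm.trans hcon.2))
  exact (hf.classRank_lt h hJ hc hne hd).not_ge (hmono hij.le)
end

/-! ### Diagonal corners are group algebras. -/

noncomputable section

open IncidenceAlgebra

/-- If the characters of a finite group with values in a field separate its points, then the field
contains a primitive root of unity whose order is the exponent of the group. -/
lemma exists_isPrimitiveRoot_exponent {H F : Type*} [Group H] [Finite H] [Field F]
    (hsep : ∀ h : H, (∀ χ : H →* F, χ h = 1) → h = 1) :
    ∃ ζ : F, IsPrimitiveRoot ζ (Monoid.exponent H) := by
  have : NeZero (Monoid.exponent H) := ⟨Monoid.exponent_ne_zero_of_finite⟩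
  obtain ⟨ζ, hζ⟩ := IsCyclic.exists_generator (α := rootsOfUnity (Monoid.exponent H) F)
  -- Every character value is a power of ζ, so raising any g to the order of ζ kills all characters,
  -- and separation applies.
  have hdvd : Monoid.exponent H ∣ orderOf ζ := by
    refine Monoid.exponent_dvd_of_forall_pow_eq_one fun g => hsep _ fun χ => ?_
    have hg : χ g ^ Monoid.exponent H = 1 := by rw [← map_pow, Monoid.pow_exponent_eq_one, map_one]
    let ω := rootsOfUnity.mkOfPowEq (χ g) hg
    have hω : ω ^ orderOf ζ = 1 := by
      rw [orderOf_eq_card_of_forall_mem_zpowers hζ]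
      exact pow_card_eq_one'
    have := congrArg (fun z : rootsOfUnity (Monoid.exponent H) F => ((z : Fˣ) : F)) hω
    simpa [ω] using this
  have hdvd' : orderOf ζ ∣ Monoid.exponent H := orderOf_dvd_of_pow_eq_one (Subtype.ext ζ.2)
  have hprim := (IsPrimitiveRoot.orderOf ζ)
  rw [Nat.dvd_antisymm hdvd' hdvd] at hprim
  exact ⟨((ζ : Fˣ) : F), IsPrimitiveRoot.coe_units_iff.mpr
    (IsPrimitiveRoot.coe_submonoidClass_iff.mpr hprim)⟩

/-- If a field contains a primitive root of unity whose order is the exponent of a finite group,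
then its characteristic does not divide the order of the group. -/
lemma not_ringChar_dvd_card {H F : Type*} [Group H] [Finite H] [Field F] {ζ : F}
    (hζ : IsPrimitiveRoot ζ (Monoid.exponent H)) : ¬ ringChar F ∣ Nat.card H := by
  intro hdvd
  have : NeZero (Monoid.exponent H) := ⟨Monoid.exponent_ne_zero_of_finite⟩
  rcases CharP.char_is_prime_or_zero F (ringChar F) with hp | h0
  · have := Fact.mk hp
    -- By Cauchy the characteristic would divide the exponent, which is nonzero in F as the order of
    -- a primitive root of unity.
    obtain ⟨g, hg⟩ := exists_prime_orderOf_dvd_card' (ringChar F) hdvd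
    have hne := hζ.neZero'.out
    exact hne ((ringChar.spec F _).mpr (hg ▸ Monoid.order_dvd_exponent g))
  · rw [h0, zero_dvd_iff] at hdvd
    exact Nat.card_pos.ne' hdvd

/-- Reads the coefficients of b off the homogeneous components of its image; both injectivity and
the reflection of degrees follow from it. -/
lemma IsGroupGrading.proj_apply_of_single_mem {F G A : Type*} [Field F] [Group G] [Ring A]
    [Algebra F A] {𝒜 : G → Submodule F A} (h : IsGroupGrading 𝒜) {H : Subgroup G}
    (ψ : MonoidAlgebra F H →ₗ[F] A) (hψ : ∀ g : H, ψ (MonoidAlgebra.single g 1) ∈ 𝒜 g)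
    (b : MonoidAlgebra F H) (g : H) :
    h.proj g (ψ b) = b.coeff g • ψ (MonoidAlgebra.single g 1) := by
  induction b using MonoidAlgebra.induction_linear with
  | zero => simp
  | add a b ha hb => rw [map_add, map_add, ha, hb, MonoidAlgebra.coeff_add, Finsupp.add_apply,
      add_smul]
  | single k r =>
    have hs : MonoidAlgebra.single k r = r • (MonoidAlgebra.single k 1 : MonoidAlgebra F H) := by
      simp
    rw [hs, map_smul, map_smul]
    by_cases hkg : k = g
    · subst hkg
      rw [h.proj_of_mem (hψ k)]
      simp
    · rw [h.proj_of_mem_of_ne (hψ k) fun h' => hkg (Subtype.ext h')]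
      simp [hkg]

namespace IsHomogeneousFrame

variable {F X G ι : Type*} [Field F] [PartialOrder X] [Finite X]
    [LocallyFiniteOrder X] [DecidableEq X] [Group G] [Fintype ι] [DecidableEq ι]
    {𝒜 : G → Submodule F (IncidenceAlgebra F X)} {e : ι → IncidenceAlgebra F X}
    {cls : X → ι}

/-- The support of the diagonal corner of the class of `x`. -/
def cornerSupport (hf : IsHomogeneousFrame 𝒜 e cls) (h : IsGroupGrading 𝒜) (x : X) :
    Subgroup G where
  carrier := {g | ∃ a ∈ 𝒜 g, e (cls x) * a * e (cls x) = a ∧ a x x = 1}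
  one_mem' := ⟨e (cls x), hf.mem _, hf.corner_idem _, by simp [hf.apply_self]⟩
  mul_mem' := by
    rintro g k ⟨a, ha, hac, hax⟩ ⟨b, hb, hbc, hbx⟩
    exact ⟨a * b, h.mul_mem _ _ _ _ ha hb, hf.corner_mul hac hbc, by
      rw [mul_apply_self, hax, hbx, mul_one]⟩
  inv_mem' := by
    rintro g ⟨a, ha, hac, hax⟩
    obtain ⟨n, hn, hgn, -⟩ := hf.exists_pow h hac ha fun h0 => by
      have := congrFun h0 x
      rw [diagHom_apply, hax] at this
      exact one_ne_zero this
    -- The exponent n - 1 could be 0, and the zeroth power leaves the corner.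
    have hg : g⁻¹ = g ^ (2 * n - 1) := by
      rw [inv_eq_iff_mul_eq_one, ← pow_succ', show 2 * n - 1 + 1 = n * 2 by omega, pow_mul, hgn,
        one_pow]
    refine ⟨a ^ (2 * n - 1), hg ▸ h.pow_mem ha _, hf.corner_pow hac (by omega), ?_⟩
    have := congrFun (map_pow (diagHom F X) a (2 * n - 1)) x
    simpa [hax] using this

/-- A diagonal corner is isomorphic to the group algebra of its support, which is a finite abelian
group whose exponent is the order of a primitive root of unity. -/
lemma exists_groupAlgebra (hf : IsHomogeneousFrame 𝒜 e cls) (h : IsGroupGrading 𝒜)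
    (hJ : ∀ k f, diagHom F X f = 0 → diagHom F X (h.proj k f) = 0) (i : ι) :
    ∃ H : Subgroup G, (Finite H ∧ IsMulCommutative H ∧ ¬ ringChar F ∣ Nat.card H ∧
        ∃ ζ : F, IsPrimitiveRoot ζ (Monoid.exponent H)) ∧
      ∃ ψ : MonoidAlgebra F H →ₙₐ[F] IncidenceAlgebra F X, Function.Injective ψ ∧ ψ 1 = e i ∧
        (∀ g : H, ψ (MonoidAlgebra.single g 1) ∈ 𝒜 g) ∧
        ∀ a, e i * a * e i = a → ∃ b, ψ b = a := by
  classical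
  obtain ⟨x, rfl⟩ := hf.surjective i
  have hex : ∀ g : hf.cornerSupport h x, ∃ a ∈ 𝒜 g, e (cls x) * a * e (cls x) = a ∧ a x x = 1 :=
    fun g => g.2
  choose w hmem hc hx using hex
  -- Each component is spanned by the generator with value 1 at x. Since evaluation at x is
  -- multiplicative, no cocycle appears in the products of these generators.
  have huniq : ∀ (g : hf.cornerSupport h x) (a : IncidenceAlgebra F X), a ∈ 𝒜 g →
      e (cls x) * a * e (cls x) = a → a = a x x • w g := by
    intro g a ha hac
    rw [← sub_eq_zero]
    refine hf.corner_eq_zero_of_homogeneous h hJ ?_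
      (sub_mem ha (Submodule.smul_mem _ _ (hmem g))) (x := x) rfl ?_
    · rw [mul_sub, sub_mul, hac, mul_smul_comm, smul_mul_assoc, hc]
    · rw [IncidenceAlgebra.sub_apply, constSMul_apply, hx]
      simp
  have hw0 : ∀ g, w g ≠ 0 := fun g h0 => by
    have := hx g
    rw [h0] at this
    exact zero_ne_one this
  have hmul : ∀ g k, w (g * k) = w g * w k := by
    intro g k
    have := huniq (g * k) (w g * w k) (h.mul_mem _ _ _ _ (hmem g) (hmem k))
      (hf.corner_mul (hc g) (hc k))
    rw [mul_apply_self, hx, hx, mul_one, one_smul] at this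
    exact this.symm
  have hone : w 1 = e (cls x) := by
    have := huniq 1 (e (cls x)) (hf.mem _) (hf.corner_idem _)
    rw [hf.apply_self, if_pos rfl, one_smul] at this
    exact this.symm
  have hfin : Finite (hf.cornerSupport h x) := by
    have hfin' : {k | 𝒜 k ≠ ⊥}.Finite :=
      WellFoundedGT.finite_ne_bot_of_iSupIndep h.isInternal.submodule_iSupIndep
    refine hfin'.subset fun g hg hbot => hw0 ⟨g, hg⟩ ?_
    have := hmem ⟨g, hg⟩
    rwa [show 𝒜 ((⟨g, hg⟩ : hf.cornerSupport h x) : G) = ⊥ from hbot, Submodule.mem_bot] at this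
  -- The corner embeds in F^X by its diagonal, so w (g * k) = w (k * g); a nonzero element has only
  -- one degree.
  have hcomm : ∀ g k : hf.cornerSupport h x, g * k = k * g := by
    intro g k
    have hwc : w (g * k) = w (k * g) := by
      rw [← sub_eq_zero]
      refine hf.corner_eq_zero_of_diagHom h hJ (i := cls x) ?_ ?_
      · rw [mul_sub, sub_mul, hc, hc]
      · rw [hmul, hmul, map_sub, map_mul, map_mul, mul_comm, sub_self]
    exact Subtype.ext (h.degree_unique (hmem (g * k)) (hwc ▸ hmem (k * g)) (hw0 _))
  -- Each point y of the class gives the character k ↦ w k y y. If all of these are 1 at g, then w g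
  -- and e (cls x) have the same diagonal, hence agree, and g is the degree of an idempotent.
  have hsep : ∀ g : hf.cornerSupport h x, (∀ χ : hf.cornerSupport h x →* F, χ g = 1) → g = 1 := by
    intro g hg
    have hwg : w g = e (cls x) := by
      rw [← sub_eq_zero]
      refine hf.corner_eq_zero_of_diagHom h hJ (i := cls x) ?_ ?_
      · rw [mul_sub, sub_mul, hc, hf.corner_idem]
      · ext y
        rw [diagHom_apply, IncidenceAlgebra.sub_apply, hf.apply_self]
        split_ifs with hy
        · let χ : hf.cornerSupport h x →* F :=
            { toFun := fun k => w k y y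
              map_one' := by rw [hone, hf.apply_self, if_pos hy]
              map_mul' := fun k l => by rw [hmul, mul_apply_self] }
          rw [show w g y y = 1 from hg χ, sub_self]
          rfl
        · rw [hf.apply_self_of_corner (hc g) (.inl hy), sub_self]
          rfl
    exact Subtype.ext (h.degree_unique (hmem g) (by rw [hwg]; exact hf.mem _) (hw0 g))
  obtain ⟨ζ, hζ⟩ := exists_isPrimitiveRoot_exponent hsep
  refine ⟨hf.cornerSupport h x, ⟨hfin, ⟨⟨hcomm⟩⟩, not_ringChar_dvd_card hζ, ζ, hζ⟩, ?_⟩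
  let ψ : MonoidAlgebra F (hf.cornerSupport h x) →ₙₐ[F] IncidenceAlgebra F X :=
    MonoidAlgebra.liftMagma F ⟨w, hmul⟩
  have hψ : ∀ g, ψ (MonoidAlgebra.single g 1) = w g := by
    intro g
    simp [ψ]
  have hψmem : ∀ g : hf.cornerSupport h x, ψ (MonoidAlgebra.single g 1) ∈ 𝒜 g := fun g => by
    rw [hψ]; exact hmem g
  refine ⟨ψ, ?_, ?_, hψmem, ?_⟩
  · refine (injective_iff_map_eq_zero ψ).mpr fun b hb => ?_
    rw [← MonoidAlgebra.coeff_eq_zero]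
    ext g
    have := h.proj_apply_of_single_mem
      (ψ : MonoidAlgebra F (hf.cornerSupport h x) →ₗ[F] IncidenceAlgebra F X) hψmem b g
    change h.proj g (ψ b) = b.coeff g • ψ _ at this
    rw [hb, map_zero, hψ, eq_comm, smul_eq_zero] at this
    simpa using this.resolve_right (hw0 g)
  · rw [MonoidAlgebra.one_def, hψ, hone]
  · intro a ha
    have hcomp : ∀ g, h.proj g a ∈ LinearMap.range
        (ψ : MonoidAlgebra F (hf.cornerSupport h x) →ₗ[F] IncidenceAlgebra F X) := by
      intro g
      by_cases h0 : h.proj g a x x = 0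
      · rw [hf.corner_eq_zero_of_homogeneous h hJ (hf.corner_proj h ha g) (h.proj_mem g a) rfl h0]
        exact zero_mem _
      · have hg : g ∈ hf.cornerSupport h x := by
          refine ⟨(h.proj g a x x)⁻¹ • h.proj g a, Submodule.smul_mem _ _ (h.proj_mem g a), ?_, ?_⟩
          · rw [mul_smul_comm, smul_mul_assoc, hf.corner_proj h ha g]
          · rw [constSMul_apply, smul_eq_mul, inv_mul_cancel₀ h0]
        rw [huniq ⟨g, hg⟩ _ (h.proj_mem g a) (hf.corner_proj h ha g)]
        exact Submodule.smul_mem _ _ ⟨_, hψ ⟨g, hg⟩⟩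
    obtain ⟨s, hs⟩ := h.exists_sum_proj a
    have : a ∈ LinearMap.range
        (ψ : MonoidAlgebra F (hf.cornerSupport h x) →ₗ[F] IncidenceAlgebra F X) := by
      rw [hs]
      exact sum_mem fun g _ => hcomp g
    exact this

end IsHomogeneousFrame
end

/-! ### Peirce corners as graded bimodules. -/

noncomputable section

/-- The corner `eAf` of an algebra `A`, for idempotents `e` and `f`. -/
def cornerSubmodule (F : Type*) {A : Type*} [Field F] [Ring A] [Algebra F A] (e f : A) :
    Submodule F A where
  carrier := {a | e * a * f = a}
  add_mem' {a b} ha hb := by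
    change e * (a + b) * f = a + b
    rw [mul_add, add_mul, show e * a * f = a from ha, show e * b * f = b from hb]
  zero_mem' := by simp
  smul_mem' c a ha := by
    change e * (c • a) * f = c • a
    rw [mul_smul_comm, smul_mul_assoc, show e * a * f = a from ha]

lemma mem_cornerSubmodule {F A : Type*} [Field F] [Ring A] [Algebra F A] {e f a : A} :
    a ∈ cornerSubmodule F e f ↔ e * a * f = a := Iff.rfl

/-- A complete system of orthogonal idempotents of degree one in a graded algebra, with respect to
which the algebra is upper triangular and its diagonal corners are graded group algebras. -/
structure IsTriangularFrame {F : Type u} {G : Type v} {A : Type w} [Field F] [Group G] [Ring A]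
    [Algebra F A] (𝒜 : G → Submodule F A) {t : ℕ} (e : Fin t → A) (H : Fin t → Subgroup G)
    (ψ : ∀ i, MonoidAlgebra F (H i) →ₙₐ[F] A) : Prop where
  grading : IsGroupGrading 𝒜
  complete : CompleteOrthogonalIdempotents e
  mem : ∀ i, e i ∈ 𝒜 1
  triangular : ∀ i j, j < i → ∀ a, e i * a * e j = 0
  injective : ∀ i, Function.Injective (ψ i)
  map_one : ∀ i, ψ i 1 = e i
  single_mem : ∀ i (g : H i), ψ i (MonoidAlgebra.single g 1) ∈ 𝒜 g
  surjective : ∀ i a, e i * a * e i = a → ∃ b, ψ i b = a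

namespace IsTriangularFrame

variable {F : Type u} {G : Type v} {A : Type w} [Field F] [Group G] [Ring A]
    [Algebra F A] {𝒜 : G → Submodule F A} {t : ℕ} {e : Fin t → A} {H : Fin t → Subgroup G}
    {ψ : ∀ i, MonoidAlgebra F (H i) →ₙₐ[F] A} (hT : IsTriangularFrame 𝒜 e H ψ)

include hT

lemma idem (i : Fin t) : e i * e i = e i := hT.complete.idem i

lemma idem_mul {i j : Fin t} {a : A} (ha : a ∈ cornerSubmodule F (e i) (e j)) : e i * a = a := by
  rw [mem_cornerSubmodule] at ha
  rw [← ha, ← mul_assoc, ← mul_assoc, hT.idem]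

lemma mul_idem {i j : Fin t} {a : A} (ha : a ∈ cornerSubmodule F (e i) (e j)) : a * e j = a := by
  rw [mem_cornerSubmodule] at ha
  rw [← ha, mul_assoc, hT.idem]

lemma corner_mem (i j : Fin t) (a : A) : e i * a * e j ∈ cornerSubmodule F (e i) (e j) := by
  rw [mem_cornerSubmodule, ← mul_assoc, ← mul_assoc, hT.idem, mul_assoc, hT.idem]

lemma mul_mem_corner {i j k : Fin t} {a b : A} (ha : a ∈ cornerSubmodule F (e i) (e j))
    (hb : b ∈ cornerSubmodule F (e j) (e k)) : a * b ∈ cornerSubmodule F (e i) (e k) := by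
  rw [mem_cornerSubmodule, ← mul_assoc, hT.idem_mul ha, mul_assoc, hT.mul_idem hb]

lemma apply_mem_corner (i : Fin t) (b : MonoidAlgebra F (H i)) :
    ψ i b ∈ cornerSubmodule F (e i) (e i) := by
  rw [mem_cornerSubmodule, ← hT.map_one, ← map_mul, ← map_mul, one_mul, mul_one]

lemma corner_corner (i j k l : Fin t) {a : A} (ha : a ∈ cornerSubmodule F (e k) (e l)) :
    e i * a * e j = if i = k ∧ j = l then a else 0 := by
  rw [mem_cornerSubmodule] at ha
  split_ifs with h
  · rw [h.1, h.2, ha]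
  · rw [← ha]
    by_cases hik : i = k
    · have hjl : l ≠ j := fun hjl => h ⟨hik, hjl.symm⟩
      rw [mul_assoc, mul_assoc (e k * a), hT.complete.ortho hjl, mul_zero, mul_zero]
    · rw [← mul_assoc, ← mul_assoc, hT.complete.ortho hik, zero_mul, zero_mul, zero_mul]

lemma eq_sum_corners (a : A) : a = ∑ i, ∑ j, e i * a * e j := by
  simp_rw [← Finset.mul_sum, ← Finset.sum_mul]
  rw [hT.complete.complete, one_mul, mul_one]

lemma corner_mul_eq_sum (i j : Fin t) (a b : A) :
    e i * (a * b) * e j = ∑ k, (e i * a * e k) * (e k * b * e j) := by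
  have : ∀ k, (e i * a * e k) * (e k * b * e j) = e i * a * e k * b * e j := fun k => by
    rw [mul_assoc (e k) b, ← mul_assoc _ (e k), mul_assoc (e i * a), hT.idem, ← mul_assoc]
  simp_rw [this]
  rw [← Finset.sum_mul, ← Finset.sum_mul, ← Finset.mul_sum, hT.complete.complete, mul_one,
    mul_assoc (e i) a b]

lemma apply_mem_of_mem {i : Fin t} {g : G} {b : MonoidAlgebra F (H i)}
    (hb : b ∈ groupAlgebraComponent F (H i) g) : ψ i b ∈ 𝒜 g := by
  induction hb using Submodule.span_induction with
  | mem b hb =>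
    obtain ⟨k, rfl, rfl⟩ := hb
    exact hT.single_mem i k
  | zero => rw [map_zero]; exact zero_mem _
  | add a b _ _ ha hb => rw [map_add]; exact add_mem ha hb
  | smul c a _ ha => rw [map_smul]; exact Submodule.smul_mem _ c ha

lemma apply_mem_iff {i : Fin t} {g : G} {b : MonoidAlgebra F (H i)} :
    ψ i b ∈ 𝒜 g ↔ b ∈ groupAlgebraComponent F (H i) g := by
  refine ⟨fun hb => ?_, hT.apply_mem_of_mem⟩
  have hcoeff : ∀ k : H i, (k : G) ≠ g → b.coeff k = 0 := by
    intro k hk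
    have h1 := hT.grading.proj_apply_of_single_mem
      (ψ i : MonoidAlgebra F (H i) →ₗ[F] A) (hT.single_mem i) b k
    change hT.grading.proj k (ψ i b) = b.coeff k • ψ i _ at h1
    rw [hT.grading.proj_of_mem_of_ne hb hk.symm, eq_comm, smul_eq_zero] at h1
    refine h1.resolve_right fun h0 => ?_
    have h2 := hT.injective i (h0.trans (map_zero (ψ i)).symm)
    exact one_ne_zero (MonoidAlgebra.single_eq_zero.mp h2)
  rw [← MonoidAlgebra.sum_coeff_single b]
  refine sum_mem fun k _ => ?_
  by_cases hk : (k : G) = g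
  · have hs : MonoidAlgebra.single k (b.coeff k) =
        b.coeff k • (MonoidAlgebra.single k 1 : MonoidAlgebra F (H i)) := by simp
    rw [hs]
    exact Submodule.smul_mem _ _ (Submodule.subset_span ⟨k, hk, rfl⟩)
  · rw [hcoeff k hk, MonoidAlgebra.single_zero]
    exact zero_mem _

omit hT in
/-- The left action of a diagonal corner. -/
abbrev leftModule (hT : IsTriangularFrame 𝒜 e H ψ) (i j : Fin t) :
    Module (MonoidAlgebra F (H i)) (cornerSubmodule F (e i) (e j)) where
  smul b m := ⟨ψ i b * m, hT.mul_mem_corner (hT.apply_mem_corner i b) m.2⟩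
  one_smul m := Subtype.ext <| show ψ i 1 * (m : A) = m by rw [hT.map_one, hT.idem_mul m.2]
  mul_smul a b m := Subtype.ext <| show ψ i (a * b) * (m : A) = ψ i a * (ψ i b * m) by
    rw [map_mul, mul_assoc]
  smul_zero a := Subtype.ext <| mul_zero (ψ i a)
  smul_add a m n := Subtype.ext <| mul_add (ψ i a) m n
  add_smul a b m := Subtype.ext <| show ψ i (a + b) * (m : A) = ψ i a * m + ψ i b * m by
    rw [map_add, add_mul]
  zero_smul m := Subtype.ext <| show ψ i 0 * (m : A) = 0 by rw [map_zero, zero_mul]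

omit hT in
/-- The right action of a diagonal corner. -/
abbrev rightModule (hT : IsTriangularFrame 𝒜 e H ψ) (i j : Fin t) :
    Module (MonoidAlgebra F (H j))ᵐᵒᵖ (cornerSubmodule F (e i) (e j)) where
  smul b m := ⟨m * ψ j b.unop, hT.mul_mem_corner m.2 (hT.apply_mem_corner j b.unop)⟩
  one_smul m := Subtype.ext <| show (m : A) * ψ j 1 = m by rw [hT.map_one, hT.mul_idem m.2]
  mul_smul a b m := Subtype.ext <|
    show (m : A) * ψ j (b.unop * a.unop) = m * ψ j b.unop * ψ j a.unop by
      rw [map_mul, mul_assoc]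
  smul_zero a := Subtype.ext <| zero_mul (ψ j a.unop)
  smul_add a m n := Subtype.ext <| add_mul (m : A) n (ψ j a.unop)
  add_smul a b m := Subtype.ext <|
    show (m : A) * ψ j (a.unop + b.unop) = m * ψ j a.unop + m * ψ j b.unop by
      rw [map_add, mul_add]
  zero_smul m := Subtype.ext <| show (m : A) * ψ j 0 = 0 by rw [map_zero, mul_zero]

omit hT in
/-- The corner `(i, j)` as a graded bimodule. -/
def bimodule (hT : IsTriangularFrame 𝒜 e H ψ) (i j : Fin t) :
    GradedBimodule.{u, v, w} F (H i) (H j) where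
  carrier := cornerSubmodule F (e i) (e j)
  leftModule := hT.leftModule i j
  rightModule := hT.rightModule i j
  leftTower :=
    letI := hT.leftModule i j
    ⟨fun c a m => Subtype.ext <| show ψ i (c • a) * (m : A) = c • (ψ i a * (m : A)) by
      rw [map_smul, smul_mul_assoc]⟩
  rightTower :=
    letI := hT.rightModule i j
    ⟨fun c a m => Subtype.ext <|
      show (m : A) * ψ j (c • a.unop) = c • ((m : A) * ψ j a.unop) by
        rw [map_smul, mul_smul_comm]⟩
  smulComm :=
    letI := hT.leftModule i j
    letI := hT.rightModule i j
    ⟨fun a b m => Subtype.ext <|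
      show ψ i a * ((m : A) * ψ j b.unop) = ψ i a * (m : A) * ψ j b.unop by rw [mul_assoc]⟩
  component g := (𝒜 g).comap (cornerSubmodule F (e i) (e j)).subtype
  -- The idempotents have degree 1, so the homogeneous projections preserve the corner.
  isInternal := hT.grading.isInternal_comap_subtype _ fun g a ha => by
    rw [mem_cornerSubmodule] at *
    rw [← hT.grading.proj_corner (hT.mem i) (hT.mem j), ha]
  left_mem g g' a m ha hm := hT.grading.mul_mem g g' _ _ (hT.apply_mem_of_mem ha) hm
  right_mem g g' m b hm hb := hT.grading.mul_mem g g' _ _ hm (hT.apply_mem_of_mem hb)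

omit hT in
/-- The product of two corners. -/
def cornerMul (hT : IsTriangularFrame 𝒜 e H ψ) (i j k : Fin t) :
    cornerSubmodule F (e i) (e j) →ₗ[F] cornerSubmodule F (e j) (e k) →ₗ[F]
      cornerSubmodule F (e i) (e k) :=
  LinearMap.mk₂ F (fun a b => ⟨a * b, hT.mul_mem_corner a.2 b.2⟩)
    (fun a a' b => Subtype.ext (add_mul (a : A) a' b))
    (fun c a b => Subtype.ext (smul_mul_assoc c (a : A) (b : A)))
    (fun a b b' => Subtype.ext (mul_add (a : A) b b'))
    (fun c a b => Subtype.ext (mul_smul_comm c (a : A) (b : A)))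

omit hT in
/-- The block triangular structure given by the corners. -/
def triangularData (hT : IsTriangularFrame 𝒜 e H ψ) : TriangularData.{u, v, w} F H where
  M {i j} _ := hT.bimodule i j
  mul {i j k} _ _ := hT.cornerMul i j k
  smul_mul {i _ _} _ _ a _ _ := Subtype.ext (mul_assoc (ψ i a) _ _)
  mul_smul {_ _ k} _ _ _ _ b := Subtype.ext (mul_assoc _ _ (ψ k b)).symm
  balanced {_ j _} _ _ _ c _ := Subtype.ext (mul_assoc _ (ψ j c) _)
  assoc _ _ _ _ _ _ := Subtype.ext (mul_assoc (G := A) _ _ _)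
  mul_mem _ _ g g' _ _ hm hn := hT.grading.mul_mem g g' _ _ hm hn

end IsTriangularFrame
end

/-! ### The block isomorphism. -/

noncomputable section

namespace IsTriangularFrame

variable {F : Type u} {G : Type v} {A : Type w} [Field F] [Group G] [Ring A]
    [Algebra F A] {𝒜 : G → Submodule F A} {t : ℕ} {e : Fin t → A} {H : Fin t → Subgroup G}
    {ψ : ∀ i, MonoidAlgebra F (H i) →ₙₐ[F] A}

/-- The diagonal blocks of an element. -/
def diagBlock (hT : IsTriangularFrame 𝒜 e H ψ) (i : Fin t) (a : A) : MonoidAlgebra F (H i) :=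
  (hT.surjective i _ (hT.corner_mem i i a)).choose

lemma apply_diagBlock (hT : IsTriangularFrame 𝒜 e H ψ) (i : Fin t) (a : A) :
    ψ i (hT.diagBlock i a) = e i * a * e i :=
  (hT.surjective i _ (hT.corner_mem i i a)).choose_spec

/-- The blocks of an element above the diagonal. -/
def offBlock (hT : IsTriangularFrame 𝒜 e H ψ) {i j : Fin t} (hij : i < j) (a : A) :
    hT.triangularData.M hij :=
  (⟨e i * a * e j, hT.corner_mem i j a⟩ : cornerSubmodule F (e i) (e j))

/-- The element of the algebra underlying a block above the diagonal. -/
def offVal (hT : IsTriangularFrame 𝒜 e H ψ) {i j : Fin t} (hij : i < j) :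
    hT.triangularData.M hij →ₗ[F] A := (cornerSubmodule F (e i) (e j)).subtype

variable (hT : IsTriangularFrame 𝒜 e H ψ)

lemma offVal_injective {i j : Fin t} (hij : i < j) : Function.Injective (hT.offVal hij) :=
  Subtype.val_injective

lemma offVal_mem {i j : Fin t} (hij : i < j) (m : hT.triangularData.M hij) :
    hT.offVal hij m ∈ cornerSubmodule F (e i) (e j) := Subtype.prop _

@[simp] lemma offVal_offBlock {i j : Fin t} (hij : i < j) (a : A) :
    hT.offVal hij (hT.offBlock hij a) = e i * a * e j := rfl

lemma offVal_smul {i j : Fin t} (hij : i < j) (b : MonoidAlgebra F (H i))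
    (m : hT.triangularData.M hij) : hT.offVal hij (b • m) = ψ i b * hT.offVal hij m := rfl

lemma offVal_op_smul {i j : Fin t} (hij : i < j) (b : MonoidAlgebra F (H j))
    (m : hT.triangularData.M hij) :
    hT.offVal hij (MulOpposite.op b • m) = hT.offVal hij m * ψ j b := rfl

lemma offVal_mul {i j k : Fin t} (hij : i < j) (hjk : j < k) (m : hT.triangularData.M hij)
    (n : hT.triangularData.M hjk) :
    hT.offVal (hij.trans hjk) (hT.triangularData.mul hij hjk m n) =
      hT.offVal hij m * hT.offVal hjk n := rfl

lemma mem_component_iff {i j : Fin t} (hij : i < j) (g : G) (m : hT.triangularData.M hij) :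
    m ∈ (hT.triangularData.M hij).component g ↔ hT.offVal hij m ∈ 𝒜 g := Iff.rfl

/-- The block decomposition of an element. -/
def blocks : A →ₗ[F] TriangularAlgebra hT.triangularData where
  toFun a := ⟨fun i => hT.diagBlock i a, fun hij => hT.offBlock hij a⟩
  map_add' a b := TriangularAlgebra.ext_blocks
    (fun i => hT.injective i <| by
      simp only [TriangularAlgebra.diag_add, map_add, apply_diagBlock, mul_add, add_mul])
    (fun i j hij => hT.offVal_injective hij <| by
      simp only [TriangularAlgebra.off_add, map_add, offVal_offBlock, mul_add, add_mul])
  map_smul' c a := TriangularAlgebra.ext_blocks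
    (fun i => hT.injective i <| by
      simp only [TriangularAlgebra.diag_smul, map_smul, apply_diagBlock, mul_smul_comm,
        smul_mul_assoc, RingHom.id_apply])
    (fun i j hij => hT.offVal_injective hij <| by
      simp only [TriangularAlgebra.off_smul, map_smul, offVal_offBlock, mul_smul_comm,
        smul_mul_assoc, RingHom.id_apply])

@[simp] lemma apply_diag_blocks (i : Fin t) (a : A) :
    ψ i ((hT.blocks a).diag i) = e i * a * e i := hT.apply_diagBlock i a

@[simp] lemma offVal_off_blocks {i j : Fin t} (hij : i < j) (a : A) :
    hT.offVal hij ((hT.blocks a).off hij) = e i * a * e j := rfl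

lemma blocks_one : hT.blocks 1 = 1 :=
  TriangularAlgebra.ext_blocks
    (fun i => hT.injective i <| by
      rw [apply_diag_blocks, TriangularAlgebra.diag_one, hT.map_one, mul_one, hT.idem])
    (fun i j hij => hT.offVal_injective hij <| by
      rw [offVal_off_blocks, TriangularAlgebra.off_one, map_zero, mul_one,
        hT.complete.ortho hij.ne])

lemma blocks_mul (a b : A) : hT.blocks (a * b) = hT.blocks a * hT.blocks b := by
  refine TriangularAlgebra.ext_blocks
    (fun i => hT.injective i ?_) (fun i j hij => hT.offVal_injective hij ?_)
  · rw [TriangularAlgebra.diag_mul, map_mul (ψ i)]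
    simp only [apply_diag_blocks]
    rw [hT.corner_mul_eq_sum, Finset.sum_eq_single i]
    · intro k _ hk
      rcases lt_or_gt_of_ne hk with hk | hk
      · rw [hT.triangular i k hk, zero_mul]
      · rw [hT.triangular k i hk, mul_zero]
    · simp
  · rw [TriangularAlgebra.off_mul, map_add, map_add, map_sum, offVal_smul, offVal_op_smul]
    simp only [offVal_mul, apply_diag_blocks, offVal_off_blocks]
    have hsum : ∑ k : Set.Ioo i j, (e i * a * e k) * (e k * b * e j) =
        ∑ k ∈ Finset.Ioo i j, (e i * a * e k) * (e k * b * e j) :=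
      (Finset.sum_subtype (Finset.Ioo i j) (fun k => by simp)
        fun k => (e i * a * e k) * (e k * b * e j)).symm
    -- Triangularity removes every k outside [i, j]. The endpoints k = i and k = j give the two
    -- bimodule actions, and the interior gives the products of blocks above the diagonal.
    have hIcc : ∑ k, (e i * a * e k) * (e k * b * e j) =
        ∑ k ∈ Finset.Icc i j, (e i * a * e k) * (e k * b * e j) := by
      refine (Finset.sum_subset (Finset.subset_univ _) fun k _ hk => ?_).symm
      rw [Finset.mem_Icc, not_and_or, not_le, not_le] at hk
      rcases hk with hk | hk
      · rw [hT.triangular i k hk, zero_mul]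
      · rw [hT.triangular k j hk, mul_zero]
    rw [hT.corner_mul_eq_sum, hIcc, ← Finset.Ico_insert_right hij.le,
      Finset.sum_insert Finset.right_notMem_Ico, ← Finset.Ioo_insert_left hij,
      Finset.sum_insert Finset.left_notMem_Ioo]
    refine Eq.trans ?_ (congrArg _ hsum.symm)
    abel

lemma blocks_injective : Function.Injective hT.blocks := by
  refine (injective_iff_map_eq_zero hT.blocks).mpr fun a ha => ?_
  rw [hT.eq_sum_corners a]
  refine Finset.sum_eq_zero fun i _ => Finset.sum_eq_zero fun j _ => ?_
  rcases lt_trichotomy i j with hij | rfl | hij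
  · rw [← hT.offVal_off_blocks hij, ha, TriangularAlgebra.off_zero, map_zero]
  · rw [← hT.apply_diag_blocks, ha, TriangularAlgebra.diag_zero, map_zero]
  · exact hT.triangular i j hij a

lemma blocks_surjective : Function.Surjective hT.blocks := by
  intro x
  let B : Fin t → Fin t → A := fun i j =>
    if hij : i < j then hT.offVal hij (x.off hij) else if i = j then ψ i (x.diag i) else 0
  have hB : ∀ i j, B i j ∈ cornerSubmodule F (e i) (e j) := by
    intro i j
    simp only [B]
    split_ifs with hij h
    · exact hT.offVal_mem hij _
    · exact h ▸ hT.apply_mem_corner i _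
    · exact zero_mem _
  -- The preimage is the sum of all blocks; orthogonality of the idempotents recovers each one.
  have hcorner : ∀ i j, e i * (∑ k, ∑ l, B k l) * e j = B i j := by
    intro i j
    simp only [Finset.mul_sum, Finset.sum_mul]
    rw [Finset.sum_eq_single i, Finset.sum_eq_single j]
    · exact hB i j
    · intro l _ hl
      rw [hT.corner_corner i j i l (hB i l), if_neg fun h => hl h.2.symm]
    · simp
    · intro k _ hk
      refine Finset.sum_eq_zero fun l _ => ?_
      rw [hT.corner_corner i j k l (hB k l), if_neg fun h => hk h.1.symm]
    · simp
  refine ⟨∑ k, ∑ l, B k l, TriangularAlgebra.ext_blocks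
    (fun i => hT.injective i ?_) (fun i j hij => hT.offVal_injective hij ?_)⟩
  · rw [apply_diag_blocks, hcorner]
    simp [B]
  · rw [offVal_off_blocks, hcorner]
    simp [B, hij]

/-- Compressing by idempotents of degree 1 preserves degree, and an element is the sum of its
corners. -/
lemma mem_iff_blocks_mem (g : G) (a : A) :
    a ∈ 𝒜 g ↔ hT.blocks a ∈ TriangularAlgebra.component hT.triangularData g := by
  constructor
  · intro ha
    have hcorner : ∀ i j, e i * a * e j ∈ 𝒜 g := by
      intro i j
      simpa using hT.grading.mul_mem _ _ _ _ (hT.grading.mul_mem _ _ _ _ (hT.mem i) ha) (hT.mem j)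
    refine ⟨fun i => ?_, fun i j hij => ?_⟩
    · rw [← hT.apply_mem_iff, apply_diag_blocks]
      exact hcorner i i
    · rw [mem_component_iff, offVal_off_blocks]
      exact hcorner i j
  · rintro ⟨hd, ho⟩
    rw [hT.eq_sum_corners a]
    refine sum_mem fun i _ => sum_mem fun j _ => ?_
    rcases lt_trichotomy i j with hij | rfl | hij
    · exact (hT.mem_component_iff hij g _).mp (ho i j hij)
    · rw [← hT.apply_diag_blocks]
      exact hT.apply_mem_of_mem (hd i)
    · rw [hT.triangular i j hij]
      exact zero_mem _

/-- The block decomposition as an isomorphism of algebras. -/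
def blocksEquiv : A ≃ₐ[F] TriangularAlgebra hT.triangularData :=
  AlgEquiv.ofBijective (AlgHom.ofLinearMap hT.blocks hT.blocks_one hT.blocks_mul)
    ⟨hT.blocks_injective, hT.blocks_surjective⟩

end IsTriangularFrame
end

theorem theorem1 {F : Type u} {X : Type v} {G : Type w} [Field F]
    [PartialOrder X] [Finite X] [LocallyFiniteOrder X] [DecidableEq X] [Group G]
    (𝒜 : G → Submodule F (IncidenceAlgebra F X)) (h𝒜 : IsGroupGrading 𝒜)
    (hFG : ringChar F = 0 ∨ Module.finrank F (IncidenceAlgebra F X) < ringChar F ∨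
      ∀ a b : G, a * b = b * a) :
    ∃ (t : ℕ) (H : Fin t → Subgroup G),
      (∀ i, Finite (H i) ∧ IsMulCommutative (H i) ∧ ¬ ringChar F ∣ Nat.card (H i) ∧
        ∃ ζ : F, IsPrimitiveRoot ζ (Monoid.exponent (H i))) ∧
      ∃ (D : TriangularData.{u, w, max u v} F H)
        (φ : IncidenceAlgebra F X ≃ₐ[F] TriangularAlgebra D),
        ∀ (g : G) (x : IncidenceAlgebra F X),
          x ∈ 𝒜 g ↔ φ x ∈ TriangularAlgebra.component D g := by
  have hJ := fun k f => h𝒜.diagHom_proj hFG k (f := f)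
  obtain ⟨t, e, cls, hf, htri⟩ := h𝒜.exists_triangular_frame hJ
  choose H hH ψ hinj hone hmem hsurj using fun i => hf.exists_groupAlgebra h𝒜 hJ i
  have hT : IsTriangularFrame 𝒜 e H ψ :=
    ⟨h𝒜, hf.complete, hf.mem, htri, hinj, hone, hmem, hsurj⟩
  exact ⟨t, H, hH, hT.triangularData, hT.blocksEquiv, hT.mem_iff_blocks_mem⟩
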